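/- Let $p\ge 2$ be an integer and let $\mathscr H$ be the field of Hahn series $\sum_{\gamma\in\mathbb Q} f_\gamma z^\gamma$ with coefficients in $\mathbb C$, value group $\mathbb Q$ and valuation $\operatorname{val}_z$. For $f\in\mathscr H\setminus\{0\}$ let $\operatorname{cld}_z f$ be the coefficient of $z^{\operatorname{val}_z f}$ in $f$; $f$ is tangent to the identity if $\operatorname{val}_z f=0$ and $\operatorname{cld}_z f=1$. Let $\phi_p$ be the automorphism $f(z)\mapsto f(z^p)$ of $\mathscr H$, and let $\mathcal D_{\mathscr H}=\mathscr H\langle\phi_p,\phi_p^{-1}\rangle$ be the ring of noncommutative Laurent polynomials with $\phi_p f=\phi_p(f)\phi_p$ for $f\in\mathscr H$. Let $n\geq 0$ and $L=a_n(z)\phi_p^n+\cdots+a_1(z)\phi_p+a_0(z)\in\mathcal D_{\mathscr H}$ with $a_0a_n\neq 0$. The Newton polygon of $L$ is the convex hull in $\mathbb R^2$ of $\{(p^i,y) : 0\le i\le n,\ a_i\ne 0,\ y\in\mathbb R,\ y\geq \operatorname{val}_z(a_i)\}$. Let $(p^{\alpha_i},\operatorname{val}_z(a_{\alpha_i}))$,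 $0\le i\le k$, be its vertices, with $0=\alpha_0<\cdots<\alpha_k=n$. The slopes of $L$ are $$\mu_i=\frac{\operatorname{val}_z(a_{\alpha_i})-\operatorname{val}_z(a_{\alpha_{i-1}})}{p^{\alpha_i}-p^{\alpha_{i-1}}}\qquad(1\le i\le k),$$ so that $\mu_1<\cdots<\mu_k$, with multiplicities $r_i=\alpha_i-\alpha_{i-1}$. For each $i$, write $z^{\mu_i}Lz^{-\mu_i}=\sum_{l} b_l(z)\phi_p^l$ and $v=\min_l\operatorname{val}_z(b_l)$; the exponents of $L$ attached to $\mu_i$ are the nonzero complex roots of the polynomial $\bigl(z^{-v}\sum_l b_l(z)X^l\bigr)_{|z=0}$. There are $r_i$ of them, counted with multiplicities; let $c_{i,1},\dots,c_{i,r_i}$ be these exponents, repeated with multiplicities and listed in any order. Then $L$ has a factorization $$L=a(z)L_k\cdots L_1$$ where - $a\in\mathscr H^\times$ satisfies $\operatorname{val}_z(a)=\operatorname{val}_z(a_0)$ and $\operatorname{cld}_z a=\Bigl(\prod_{i=1}^k\prod_{j=1}^{r_i}(-c_{i,j})^{-1}\Bigr)\operatorname{cld}_z a_0$; - for each $i\in\{1,\dots,k\}$,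 $$L_i=(z^{\nu_i}\phi_p-c_{i,r_i})h_{i,r_i}(z)^{-1}\cdots(z^{\nu_i}\phi_p-c_{i,1})h_{i,1}(z)^{-1}$$ for some $h_{i,j}\in\mathscr H^\times$ tangent to the identity, with $$\nu_i=(p-1)\bigl(p^{r_1+\cdots+r_{i-1}}(\mu_i-\mu_{i-1})+\cdots+p^{r_1}(\mu_2-\mu_1)+\mu_1\bigr).$$ -/

import Mathlib

noncomputable section

namespace Mahler

/-- The field of Hahn series in `z` with complex coefficients and value group `ℚ`. -/
abbrev Hahn : Type := HahnSeries ℚ ℂ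

/-- The monomial `z ^ γ`. -/
def zpw (γ : ℚ) : Hahn := HahnSeries.single γ 1

/-- A nonzero Hahn series is tangent to the identity if its valuation is `0` and the coefficient
of its lowest-order term is `1`. -/
def TangentToId (f : Hahn) : Prop := f ≠ 0 ∧ f.orderTop = 0 ∧ f.leadingCoeff = 1

/-- For `q > 0`, the substitution `z ↦ z ^ q`, i.e. `∑ f_γ z^γ ↦ ∑ f_γ z^(q γ)`. -/
def substPow (q : ℚ) (hq : 0 < q) : Hahn →+* Hahn :=
  HahnSeries.embDomainRingHom (AddMonoidHom.mulLeft q)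
    (fun _ _ h => mul_left_cancel₀ hq.ne' h) (fun _ _ => mul_le_mul_iff_right₀ hq)

theorem substPow_coeff (q : ℚ) (hq : 0 < q) (f : Hahn) (γ : ℚ) :
    (substPow q hq f).coeff γ = f.coeff (γ / q) := by
  have h : γ = q * (γ / q) := by field_simp
  conv_lhs => rw [h]
  exact HahnSeries.embDomain_coeff
    (f := ⟨⟨fun x : ℚ => q * x, fun _ _ h => mul_left_cancel₀ hq.ne' h⟩, mul_le_mul_iff_right₀ hq⟩)

section

variable (p : ℕ) [p.AtLeastTwo]

theorem p_pos : (0 : ℚ) < (p : ℚ) := by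
  have h := Nat.AtLeastTwo.prop (n := p)
  exact_mod_cast (by omega : 0 < p)

/-- The automorphism `φ_p` of the field of Hahn series, `f(z) ↦ f(z ^ p)`. -/
def phi : Hahn ≃+* Hahn :=
  { substPow (p : ℚ) (p_pos p) with
    invFun := substPow ((p : ℚ)⁻¹) (inv_pos.mpr (p_pos p))
    left_inv := fun f => by
      have h := (p_pos p).ne'
      ext γ
      change (substPow _ _ (substPow _ _ f)).coeff γ = _
      rw [substPow_coeff, substPow_coeff]
      congr 1
      field_simp
    right_inv := fun f => by
      have h := (p_pos p).ne'
      ext γ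
      change (substPow _ _ (substPow _ _ f)).coeff γ = _
      rw [substPow_coeff, substPow_coeff]
      congr 1
      field_simp }

theorem phi_coeff (f : Hahn) (γ : ℚ) : (phi p f).coeff γ = f.coeff (γ / p) :=
  substPow_coeff (p : ℚ) (p_pos p) f γ

/-- The action of `ℤ` on Hahn series in which `m` acts as `φ_p ^ m`. -/
@[reducible] def zAction : MulSemiringAction (Multiplicative ℤ) Hahn :=
  MulSemiringAction.compHom Hahn (zpowersHom (RingAut Hahn) (phi p))

/-- The Ore algebra of Mahler operators: finite sums `∑ a_i φ_p ^ i` (`i : ℤ`) with coefficients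
`a_i` in the field of Hahn series, with the multiplication determined by `φ_p f = φ_p(f) φ_p`. -/
def Op (_p : ℕ) : Type := SkewMonoidAlgebra Hahn (Multiplicative ℤ)

instance : Ring (Op p) :=
  letI := zAction p
  inferInstanceAs (Ring (SkewMonoidAlgebra Hahn (Multiplicative ℤ)))

namespace Op

/-- A Hahn series, viewed as an operator of degree `0`. -/
def const (f : Hahn) : Op p :=
  (SkewMonoidAlgebra.single 1 f : SkewMonoidAlgebra Hahn (Multiplicative ℤ))

/-- The operator `φ_p`. -/
def Phi : Op p :=
  (SkewMonoidAlgebra.single (Multiplicative.ofAdd 1) 1 :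
    SkewMonoidAlgebra Hahn (Multiplicative ℤ))

/-- The commutation rule of the Ore algebra. -/
theorem Phi_mul_const (f : Hahn) : Phi p * const p f = const p (phi p f) * Phi p := by
  let _ := zAction p
  have h := SkewMonoidAlgebra.single_mul_single (k := Hahn) (G := Multiplicative ℤ)
    (a₁ := Multiplicative.ofAdd 1) (a₂ := 1) (b₁ := 1) (b₂ := f)
  have h' := SkewMonoidAlgebra.single_mul_single (k := Hahn) (G := Multiplicative ℤ)
    (a₁ := 1) (a₂ := Multiplicative.ofAdd 1) (b₁ := phi p f) (b₂ := 1)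
  refine h.trans (Eq.trans ?_ h'.symm)
  rw [one_smul, mul_one, mul_one, one_mul, one_mul]
  congr 1

end Op

end

namespace Op

section

variable {p : ℕ}

/-- The coefficient of `φ_p ^ i` in `L`. -/
def coef (L : Op p) (i : ℤ) : Hahn :=
  SkewMonoidAlgebra.coeff (k := Hahn) (G := Multiplicative ℤ) L (Multiplicative.ofAdd i)

/-- The finite set of the `i : ℤ` such that the coefficient of `φ_p ^ i` in `L` is nonzero. -/
def supp (L : Op p) : Finset ℤ :=
  (SkewMonoidAlgebra.support (k := Hahn) (G := Multiplicative ℤ) L).map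
    Multiplicative.toAdd.toEmbedding

theorem mem_supp (L : Op p) (i : ℤ) : i ∈ L.supp ↔ L.coef i ≠ 0 := by
  simp only [supp, coef, Finset.mem_map_equiv]
  exact SkewMonoidAlgebra.mem_support_iff

/-! ### Newton polygon, slopes and their multiplicities -/

/-- The Newton polygon of `L`: the convex hull of the `(p ^ i, y)` with `y ≥ val_z (a_i)`
(there is no such point when `a_i = 0`, since then `val_z (a_i) = +∞`). -/
def newtonPolygon (L : Op p) : Set (ℝ × ℝ) :=
  convexHull ℝ {P | ∃ i : ℤ, L.coef i ≠ 0 ∧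
    P.1 = (p : ℝ) ^ i ∧ (((L.coef i).order : ℚ) : ℝ) ≤ P.2}

/-- `(p ^ i, val_z (a_i))` is a vertex of the Newton polygon of `L`. -/
def IsVertex (L : Op p) (i : ℤ) : Prop :=
  L.coef i ≠ 0 ∧
    ((p : ℝ) ^ i, (((L.coef i).order : ℚ) : ℝ)) ∈ Set.extremePoints ℝ L.newtonPolygon

/-- The vertices with indices `i < j` are consecutive. -/
def IsEdge (L : Op p) (i j : ℤ) : Prop :=
  L.IsVertex i ∧ L.IsVertex j ∧ i < j ∧ ∀ m, L.IsVertex m → ¬ (i < m ∧ m < j)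

/-- The slope of the vector joining `(p ^ i, val_z (a_i))` to `(p ^ j, val_z (a_j))`. -/
def edgeSlope (L : Op p) (i j : ℤ) : ℚ :=
  ((L.coef j).order - (L.coef i).order) / ((p : ℚ) ^ j - (p : ℚ) ^ i)

/-- `μ` is a slope of `L`, with multiplicity `r`. -/
def IsSlopeWithMult (L : Op p) (μ : ℚ) (r : ℕ) : Prop :=
  ∃ i j : ℤ, L.IsEdge i j ∧ L.edgeSlope i j = μ ∧ j - i = (r : ℤ)

/-- The set of slopes of `L`. -/
def slopes (L : Op p) : Set ℚ := {μ | ∃ r : ℕ, L.IsSlopeWithMult μ r}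

/-! ### Characteristic polynomials and exponents -/

end

/-- The gauge transform `g⁻¹ L g`. -/
def gauge {p : ℕ} [p.AtLeastTwo] (L : Op p) (g : Hahn) : Op p := const p g⁻¹ * L * const p g

/-- `θ_μ = z ^ (μ / (p - 1))`, so that `φ_p(θ_μ) = z ^ μ θ_μ`. -/
def theta (p : ℕ) (μ : ℚ) : Hahn := zpw (μ / ((p : ℚ) - 1))

/-- The least valuation of the coefficients of a nonzero operator. -/
def val {p : ℕ} (M : Op p) : ℚ := (M.supp.inf fun i => (M.coef i).orderTop).untopD 0

/-- The characteristic polynomial attached to the slope `μ` of an operator `L` which involves only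
nonnegative powers of `φ_p`: writing `∑ b_i φ_p ^ i` for the gauge transform of `L` by
`θ_{-(p-1)μ}` and `v` for its valuation, this is the value at `z = 0` of `z ^ (-v) ∑ b_i X ^ i`. -/
def charPoly {p : ℕ} [p.AtLeastTwo] (L : Op p) (μ : ℚ) : Polynomial ℂ :=
  let M := L.gauge (theta p (-((p : ℚ) - 1) * μ))
  ∑ i ∈ M.supp, Polynomial.monomial i.toNat ((zpw (-M.val) * M.coef i).coeff 0)

/-- The exponents of `L` attached to the slope `μ`, repeated with multiplicities: the nonzero
complex roots of the characteristic polynomial. -/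
def exponents {p : ℕ} [p.AtLeastTwo] (L : Op p) (μ : ℚ) : Multiset ℂ :=
  (L.charPoly μ).roots.filter (fun c => c ≠ 0)

end Op

/-! ### The data of the factorization

Slopes and multiplicities are indexed by `Fin k`, so that `μ i`, `r i` (`0 ≤ i < k`) stand for the
`(i+1)`-st slope and its multiplicity. -/

/-- The slope preceding `μ i`, with the convention that the slope preceding the first one is `0`. -/
def prevSlope {k : ℕ} (μ : Fin k → ℚ) (i : Fin k) : ℚ :=
  if 0 < i.val then μ ⟨i.val - 1, by omega⟩ else 0

/-- In the usual indexing from `1`: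
`ν_i = (p-1) (p^(r_1+⋯+r_(i-1)) (μ_i - μ_(i-1)) + ⋯ + p^(r_1) (μ_2 - μ_1) + μ_1)`. -/
def nu (p : ℕ) {k : ℕ} (μ : Fin k → ℚ) (r : Fin k → ℕ) (i : Fin k) : ℚ :=
  ((p : ℚ) - 1) *
    ∑ j ∈ Finset.Iic i, (p : ℚ) ^ (∑ l ∈ Finset.Iio j, r l) * (μ j - prevSlope μ j)

/-- The operator `(z ^ ν φ_p - c) h⁻¹`. -/
def linFactor (p : ℕ) [p.AtLeastTwo] (ν : ℚ) (c : ℂ) (h : Hahn) : Op p :=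
  (Op.const p (zpw ν) * Op.Phi p - Op.const p (HahnSeries.C c)) * Op.const p h⁻¹

/-- The product `x_(m-1) ⋯ x_1 x_0`, the factor of largest index standing on the left. -/
def descProd {R : Type*} [Monoid R] {m : ℕ} (x : Fin m → R) : R := (List.ofFn x).reverse.prod

end Mahler

end

/-! The proof divides on the right by one first order factor at a time, always at the smallest slope
`m`. With `e_c` a formal symbol satisfying `φ(e_c) = c e_c`, the factor `(z^((p-1)m) φ - c) h⁻¹`
kills `h z^(-m) e_c`, so it divides `∑ a l φ^l` as soon as `∑ a l c^l z^(-p^l m) φ^l(h) = 0`. Since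
`m` is the smallest slope, after multiplication by a power of `z` this equation has coefficients of
nonnegative valuation and a constant coefficient of valuation `0`. As `c` is an exponent, `h = 1`
solves it modulo positive valuations. As `φ` multiplies valuations by `p`, successive approximation
converges to an `h` tangent to the identity (`exists_tangent_solution`, `exists_isQuotient`).

It remains to follow slopes and exponents through the division. For a line of slope `μ` below the
points `(p^l, val (a l))`, `initPoly` collects the coefficients on the line; its nonzero roots are
the exponents at `μ`. Comparing coefficients in `a = b · factor` relates the initial polynomials of
`a` to those of `b` (`IsQuotient.aboveLine`). Hence the quotient loses one copy of `(m, c)`, and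
every other pair `(μ, c')` becomes `(p(μ - m) + m, c')` (`IsQuotient.hasExponents`). Iterating this
transformation of slopes produces the `ν_i` (`nu_succ`).

The induction runs on the multiset of pairs (slope, exponent), with the bound `n` on the degree
fixed and leading coefficients allowed to vanish. The Newton polygon enters only at the end, where
this multiset is identified for `L` (`hasExponents_opOf`). -/

namespace Mahler

/-! ### Valuations, leading coefficients and limits of Hahn series -/

/-- All coefficients of `f` of index less than `α` vanish, i.e. `α ≤ val_z f`. -/
def OrdGE (f : Hahn) (α : ℚ) : Prop := ∀ γ < α, f.coeff γ = 0

theorem ordGE_iff {f : Hahn} {α : ℚ} : OrdGE f α ↔ (α : WithTop ℚ) ≤ f.orderTop := by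
  rw [HahnSeries.le_orderTop_iff_forall]
  exact forall_congr' fun γ => by rw [WithTop.coe_lt_coe]

theorem ordGE_iff_order {f : Hahn} (hf : f ≠ 0) {α : ℚ} : OrdGE f α ↔ α ≤ f.order := by
  rw [ordGE_iff, ← HahnSeries.order_eq_orderTop_of_ne_zero hf, WithTop.coe_le_coe]

theorem ordGE_order (f : Hahn) : OrdGE f f.order := fun _ h =>
  HahnSeries.coeff_eq_zero_of_lt_order h

theorem ordGE_zero (α : ℚ) : OrdGE 0 α := fun _ _ => rfl

theorem OrdGE.mono {f : Hahn} {α β : ℚ} (h : OrdGE f α) (hb : β ≤ α) : OrdGE f β :=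
  fun γ hγ => h γ (hγ.trans_le hb)

theorem OrdGE.add {f g : Hahn} {α : ℚ} (hf : OrdGE f α) (hg : OrdGE g α) : OrdGE (f + g) α :=
  fun γ hγ => by rw [HahnSeries.coeff_add, hf γ hγ, hg γ hγ, add_zero]

theorem OrdGE.neg {f : Hahn} {α : ℚ} (hf : OrdGE f α) : OrdGE (-f) α :=
  fun γ hγ => by rw [HahnSeries.coeff_neg, hf γ hγ, neg_zero]

theorem OrdGE.sum {ι : Type*} {s : Finset ι} {f : ι → Hahn} {α : ℚ}
    (hf : ∀ i ∈ s, OrdGE (f i) α) : OrdGE (∑ i ∈ s, f i) α :=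
  Finset.sum_induction f (OrdGE · α) (fun _ _ h h' => h.add h') (ordGE_zero α) hf

theorem OrdGE.mul {f g : Hahn} {α β : ℚ} (hf : OrdGE f α) (hg : OrdGE g β) :
    OrdGE (f * g) (α + β) := by
  rw [ordGE_iff] at *
  exact (add_le_add hf hg).trans HahnSeries.orderTop_add_le_mul

theorem OrdGE.eq_zero {f : Hahn} (h : ∀ α, ∃ β, α < β ∧ OrdGE f β) : f = 0 := by
  ext γ
  obtain ⟨β, hb, h⟩ := h γ
  exact h γ hb

theorem coeff_mul_add {f g : Hahn} {α β : ℚ} (hf : OrdGE f α) (hg : OrdGE g β) :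
    (f * g).coeff (α + β) = f.coeff α * g.coeff β := by
  rw [HahnSeries.coeff_mul, Finset.sum_eq_single (α, β)]
  · rintro ⟨i, j⟩ hij hne
    rw [Finset.mem_antidiagonal] at hij
    obtain ⟨hi, hj, h⟩ := hij
    have h1 : α ≤ i := not_lt.1 fun h => hi (hf i h)
    have h2 : β ≤ j := not_lt.1 fun h => hj (hg j h)
    dsimp only at h
    exact absurd (Prod.ext (by dsimp; linarith) (by dsimp; linarith)) hne
  · intro h
    rw [Finset.mem_antidiagonal, not_and_or, not_and_or] at h
    rcases h with h | h | h
    · rw [HahnSeries.mem_support, not_not] at h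
      rw [h, zero_mul]
    · rw [HahnSeries.mem_support, not_not] at h
      rw [h, mul_zero]
    · exact absurd rfl h

theorem zpw_add (α β : ℚ) : zpw (α + β) = zpw α * zpw β := by
  simp [zpw, HahnSeries.single_mul_single]

theorem zpw_ne_zero (α : ℚ) : zpw α ≠ 0 := HahnSeries.single_ne_zero one_ne_zero

theorem zpw_inv (α : ℚ) : (zpw α)⁻¹ = zpw (-α) := by simp [zpw, HahnSeries.inv_single]

theorem coeff_mul_zpw (f : Hahn) (α γ : ℚ) : (f * zpw α).coeff γ = f.coeff (γ - α) := by
  simp [zpw, HahnSeries.coeff_mul_single]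

theorem coeff_zpw_mul (f : Hahn) (α γ : ℚ) : (zpw α * f).coeff γ = f.coeff (γ - α) := by
  rw [mul_comm, coeff_mul_zpw]

theorem coeff_C_mul (c : ℂ) (f : Hahn) (γ : ℚ) : (HahnSeries.C c * f).coeff γ = c * f.coeff γ := by
  simp

theorem coeff_sum {ι : Type*} (s : Finset ι) (f : ι → Hahn) (γ : ℚ) :
    (∑ i ∈ s, f i).coeff γ = ∑ i ∈ s, (f i).coeff γ := by
  simp

theorem order_eq_of_coeff {f : Hahn} {α : ℚ} (h : OrdGE f α) (h0 : f.coeff α ≠ 0) :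
    f.orderTop = α :=
  le_antisymm (HahnSeries.orderTop_le_of_coeff_ne_zero h0) (ordGE_iff.1 h)

theorem leadingCoeff_eq_of_coeff {f : Hahn} {α : ℚ} (h : OrdGE f α) (h0 : f.coeff α ≠ 0) :
    f.leadingCoeff = f.coeff α := by
  have hf : f ≠ 0 := by rintro rfl; exact h0 rfl
  have h1 := order_eq_of_coeff h h0
  rw [← HahnSeries.order_eq_orderTop_of_ne_zero hf, WithTop.coe_inj] at h1
  rw [HahnSeries.leadingCoeff_eq, h1]

theorem tangentToId_iff {h : Hahn} : TangentToId h ↔ OrdGE h 0 ∧ h.coeff 0 = 1 := by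
  constructor
  · rintro ⟨h0, h1, h2⟩
    have h3 : h.order = 0 := by
      rw [← HahnSeries.order_eq_orderTop_of_ne_zero h0] at h1
      exact_mod_cast h1
    exact ⟨ordGE_iff.2 h1.ge, by rw [HahnSeries.leadingCoeff_eq, h3] at h2; exact h2⟩
  · rintro ⟨h1, h2⟩
    have h3 : h.coeff 0 ≠ 0 := by rw [h2]; exact one_ne_zero
    refine ⟨by rintro rfl; exact h3 rfl, order_eq_of_coeff h1 h3, ?_⟩
    rw [leadingCoeff_eq_of_coeff h1 h3, h2]

/-- A sequence of Hahn series whose consecutive differences have valuations bounded below by a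
nondecreasing unbounded sequence converges. -/
theorem exists_limit (s : ℕ → Hahn) (e : ℕ → ℚ) (he : Monotone e) (hu : ∀ γ, ∃ m, γ < e m)
    (hs : ∀ m, OrdGE (s (m + 1) - s m) (e m)) : ∃ t : Hahn, ∀ m, OrdGE (t - s m) (e m) := by
  have hst : ∀ m m', m ≤ m' → ∀ γ < e m, (s m').coeff γ = (s m).coeff γ := by
    intro m m' hmm
    induction m', hmm using Nat.le_induction with
    | base => exact fun _ _ => rfl
    | succ m' hmm ih =>
      intro γ hγ
      have h := hs m' γ (hγ.trans_le (he hmm))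
      rw [HahnSeries.coeff_sub, sub_eq_zero] at h
      rw [h, ih γ hγ]
  choose N hN using hu
  have key : ∀ m, ∀ γ < e m, (s (N γ)).coeff γ = (s m).coeff γ := by
    intro m γ hγ
    rcases le_total m (N γ) with h | h
    · exact hst m _ h γ hγ
    · exact (hst _ m h γ (hN γ)).symm
  -- Each coefficient is eventually constant along `s`. The support is well ordered because a
  -- descending sequence in it stays below its first term `f 0`, a range where the limit agrees with
  -- the single series `s (N (f 0))`.
  let t : Hahn := ⟨fun γ => (s (N γ)).coeff γ, by
    refine Set.IsWF.isPWO ?_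
    rw [Set.isWF_iff_no_descending_seq]
    intro f hf hmem
    have hlt : ∀ i, f i < e (N (f 0)) := fun i => (hf.antitone (Nat.zero_le i)).trans_lt (hN _)
    refine (Set.isWF_iff_no_descending_seq.1 (s (N (f 0))).isWF_support) f hf fun i => ?_
    have := hmem i
    rw [Function.mem_support, key _ _ (hlt i)] at this
    exact this⟩
  refine ⟨t, fun m γ hγ => ?_⟩
  rw [HahnSeries.coeff_sub, sub_eq_zero]
  exact key m γ hγ

/-! ### Substitutions `z ↦ z^(p^i)` and Mahler equations -/

variable (p : ℕ) [p.AtLeastTwo]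

theorem one_lt_p : (1 : ℚ) < p := by exact_mod_cast Nat.AtLeastTwo.one_lt (n := p)

/-- The substitution `z ↦ z ^ (p ^ i)`. -/
noncomputable def phiPow (i : ℕ) : Hahn →+* Hahn := substPow ((p : ℚ) ^ i) (pow_pos (p_pos p) i)

theorem phiPow_coeff (i : ℕ) (f : Hahn) (γ : ℚ) :
    (phiPow p i f).coeff γ = f.coeff (γ / (p : ℚ) ^ i) := substPow_coeff _ _ f γ

theorem phiPow_zero (f : Hahn) : phiPow p 0 f = f := by
  ext γ
  rw [phiPow_coeff, pow_zero, div_one]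

theorem phi_phiPow (i : ℕ) (f : Hahn) : phi p (phiPow p i f) = phiPow p (i + 1) f := by
  ext γ
  rw [phi_coeff, phiPow_coeff, phiPow_coeff, pow_succ', div_div]

theorem phiPow_zpw (i : ℕ) (α : ℚ) : phiPow p i (zpw α) = zpw ((p : ℚ) ^ i * α) := by
  have h := (pow_pos (p_pos p) i).ne'
  ext γ
  rw [phiPow_coeff, zpw, zpw, HahnSeries.coeff_single, HahnSeries.coeff_single]
  congr 1
  rw [div_eq_iff h, mul_comm]

theorem phiPow_C (i : ℕ) (c : ℂ) : phiPow p i (HahnSeries.C c) = HahnSeries.C c := by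
  ext γ
  rw [phiPow_coeff, HahnSeries.C_apply, HahnSeries.coeff_single, HahnSeries.coeff_single]
  congr 1
  rw [div_eq_zero_iff, or_iff_left (pow_pos (p_pos p) i).ne']

variable {p}

theorem OrdGE.phiPow {f : Hahn} {α : ℚ} (h : OrdGE f α) (i : ℕ) :
    OrdGE (phiPow p i f) ((p : ℚ) ^ i * α) := fun γ hγ => by
  rw [phiPow_coeff]
  exact h _ (by rwa [div_lt_iff₀ (pow_pos (p_pos p) i), mul_comm])

theorem TangentToId.phiPow {h : Hahn} (hh : TangentToId h) (i : ℕ) :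
    TangentToId (phiPow p i h) := by
  rw [tangentToId_iff] at *
  refine ⟨?_, ?_⟩
  · simpa using hh.1.phiPow (p := p) i
  · rw [phiPow_coeff, zero_div, hh.2]

theorem TangentToId.coeff_mul {h f : Hahn} (hh : TangentToId h) {α : ℚ} (hf : OrdGE f α) :
    (f * h).coeff α = f.coeff α := by
  rw [tangentToId_iff] at hh
  have := coeff_mul_add hf hh.1
  rwa [hh.2, add_zero, mul_one] at this

theorem TangentToId.ordGE_mul_iff {h f : Hahn} (hh : TangentToId h) {α : ℚ} :
    OrdGE (f * h) α ↔ OrdGE f α := by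
  rw [ordGE_iff, ordGE_iff, HahnSeries.orderTop_mul, hh.2.1, add_zero]

theorem ordGE_inv {f : Hahn} (hf : OrdGE f 0) (h0 : f.coeff 0 ≠ 0) : OrdGE f⁻¹ 0 := by
  have hne : f ≠ 0 := by rintro rfl; exact h0 rfl
  have h3 : f * f⁻¹ = 1 := mul_inv_cancel₀ hne
  have := congrArg HahnSeries.orderTop h3
  rw [HahnSeries.orderTop_mul, order_eq_of_coeff hf h0, WithTop.coe_zero, zero_add,
    HahnSeries.orderTop_one] at this
  exact ordGE_iff.2 this.ge

theorem exists_pos_ordGE {f : Hahn} (hf : OrdGE f 0) (h0 : f.coeff 0 = 0) :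
    ∃ δ > 0, OrdGE f δ := by
  by_cases h : f = 0
  · exact ⟨1, one_pos, h ▸ ordGE_zero 1⟩
  · refine ⟨f.order, ?_, ordGE_order f⟩
    refine lt_of_le_of_ne ((ordGE_iff_order h).1 hf) fun he => ?_
    exact HahnSeries.coeff_order_eq_zero.not.2 h (by rw [← he, h0])

variable (p) in
/-- A Mahler equation with coefficients of nonnegative valuation, whose constant coefficient is a
unit, has a solution tangent to the identity as soon as `1` is a solution modulo positive
valuations. -/
theorem exists_tangent_solution (n : ℕ) (d : ℕ → Hahn) (hd : ∀ i ≤ n, OrdGE (d i) 0)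
    (hd0 : (d 0).coeff 0 ≠ 0) (hsum : ∑ i ∈ Finset.range (n + 1), (d i).coeff 0 = 0) :
    ∃ h, TangentToId h ∧ ∑ i ∈ Finset.range (n + 1), d i * phiPow p i h = 0 := by
  have hp := one_lt_p p
  have hp0 := p_pos p
  let T : Hahn →+ Hahn :=
    { toFun := fun x => ∑ i ∈ Finset.range (n + 1), d i * phiPow p i x
      map_zero' := by simp
      map_add' := fun x y => by simp [mul_add, Finset.sum_add_distrib] }
  have hT : ∀ x, T x = ∑ i ∈ Finset.range (n + 1), d i * phiPow p i x := fun _ => rfl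
  have hdne : d 0 ≠ 0 := by intro h; rw [h] at hd0; exact hd0 rfl
  have hinv := ordGE_inv (hd 0 (Nat.zero_le n)) hd0
  have hterm : ∀ i ≤ n, ∀ x α, OrdGE x α → OrdGE (d i * phiPow p i x) ((p : ℚ) ^ i * α) := by
    intro i hi x α hx
    simpa using (hd i hi).mul (hx.phiPow (p := p) i)
  have hT0 : ∀ x, ∀ α ≥ 0, OrdGE x α → OrdGE (T x) α := by
    intro x α hα hx
    rw [hT]
    refine OrdGE.sum fun i hi => (hterm i (by simpa [Nat.lt_succ_iff] using hi) x α hx).mono ?_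
    exact le_mul_of_one_le_left hα (one_le_pow₀ hp.le)
  -- The contraction: modulo valuation `p α`, the operator `T` is multiplication by the unit `d 0`,
  -- since the terms with `i ≥ 1` have valuation at least `p^i α`.
  have hT1 : ∀ x, ∀ α ≥ 0, OrdGE x α → OrdGE (T x - d 0 * x) (p * α) := by
    intro x α hα hx
    rw [hT, Finset.sum_range_succ', phiPow_zero, add_sub_cancel_right]
    refine OrdGE.sum fun i hi => (hterm (i + 1) (by simpa using hi) x α hx).mono ?_
    refine mul_le_mul_of_nonneg_right ?_ hα
    exact le_self_pow₀ hp.le (Nat.succ_ne_zero i)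
  have h1 : T 1 = ∑ i ∈ Finset.range (n + 1), d i := by rw [hT]; simp
  obtain ⟨δ, hδ, hTδ⟩ : ∃ δ > 0, OrdGE (T 1) δ := by
    refine exists_pos_ordGE ?_ ?_
    · rw [h1]
      exact OrdGE.sum fun i hi => hd i (by simpa [Nat.lt_succ_iff] using hi)
    · rw [h1, coeff_sum, hsum]
  -- Newton-like iteration: each correction by `(d 0)⁻¹ T (s m)` cancels the main part of the error,
  -- so the error bound goes from `p^m δ` to `p^(m+1) δ`.
  let s : ℕ → Hahn := fun m => Nat.rec 1 (fun _ x => x - (d 0)⁻¹ * T x) m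
  have hs0 : s 0 = 1 := rfl
  have hs : ∀ m, s (m + 1) = s m - (d 0)⁻¹ * T (s m) := fun _ => rfl
  have he0 : ∀ m : ℕ, 0 ≤ (p : ℚ) ^ m * δ := fun m => by positivity
  have hu : ∀ m x, OrdGE x ((p : ℚ) ^ m * δ) → OrdGE ((d 0)⁻¹ * x) ((p : ℚ) ^ m * δ) := by
    intro m x hx
    simpa using hinv.mul hx
  have hTs : ∀ m, OrdGE (T (s m)) ((p : ℚ) ^ m * δ) := by
    intro m
    induction m with
    | zero => rw [hs0]; simpa using hTδ
    | succ m ih =>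
      have h2 := (hT1 _ _ (he0 m) (hu m _ ih)).neg
      rw [mul_inv_cancel_left₀ hdne] at h2
      rw [hs, map_sub, pow_succ', mul_assoc]
      simpa using h2
  obtain ⟨t, ht⟩ := exists_limit s (fun m => (p : ℚ) ^ m * δ)
    (fun m m' h => mul_le_mul_of_nonneg_right (pow_le_pow_right₀ hp.le h) hδ.le)
    (fun γ => by
      obtain ⟨m, hm⟩ := pow_unbounded_of_one_lt (γ / δ) hp
      exact ⟨m, (div_lt_iff₀ hδ).1 hm⟩)
    (fun m => by
      have := (hu m _ (hTs m)).neg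
      rw [hs]
      simpa using this)
  refine ⟨t, ?_, ?_⟩
  · have h2 : OrdGE (t - 1) δ := by simpa [s] using ht 0
    rw [tangentToId_iff]
    refine ⟨fun γ hγ => ?_, ?_⟩
    · have := h2 γ (hγ.trans hδ)
      rw [HahnSeries.coeff_sub, sub_eq_zero] at this
      rw [this, HahnSeries.coeff_one, if_neg hγ.ne]
    · have := h2 0 hδ
      rw [HahnSeries.coeff_sub, sub_eq_zero] at this
      rw [this, HahnSeries.coeff_one, if_pos rfl]
  · rw [← hT]
    refine OrdGE.eq_zero fun α => ?_
    obtain ⟨m, hm⟩ := pow_unbounded_of_one_lt (α / δ) hp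
    refine ⟨_, (div_lt_iff₀ hδ).1 hm, ?_⟩
    have := (hT0 _ _ (he0 m) (ht m)).add (hTs m)
    rwa [map_sub, sub_add_cancel] at this

end Mahler

/-! ### Initial polynomials and right division by a first order factor -/

namespace Mahler
open Polynomial

variable (p : ℕ)

/-- The polynomial formed by the coefficients of `z ^ (w + p ^ l μ)` in the `a l`, `l ≤ n`. -/
noncomputable def initPoly (n : ℕ) (a : ℕ → Hahn) (μ w : ℚ) : ℂ[X] :=
  ∑ l ∈ Finset.range (n + 1), monomial l ((a l).coeff (w + (p : ℚ) ^ l * μ))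

/-- The points `(p ^ l, val_z (a l))`, `l ≤ n`, lie on or above the line of slope `μ` and
ordinate `w` at the origin. -/
def AboveLine (n : ℕ) (a : ℕ → Hahn) (μ w : ℚ) : Prop :=
  ∀ l ≤ n, OrdGE (a l) (w + (p : ℚ) ^ l * μ)

/-- `S` is the multiset of the pairs `(slope, exponent)` of `∑ a l φ ^ l`. -/
def HasExponents (n : ℕ) (a : ℕ → Hahn) (S : Multiset (ℚ × ℂ)) : Prop :=
  ∀ μ w, AboveLine p n a μ w → initPoly p n a μ w ≠ 0 →
    (initPoly p n a μ w).roots.filter (fun c => c ≠ 0) = (S.filter (fun x => x.1 = μ)).map Prod.snd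

/-- `∑ a l φ ^ l = (∑ b l φ ^ l) (z ^ ((p - 1) m) φ - c) h⁻¹`, coefficientwise. -/
structure IsQuotient [p.AtLeastTwo] (n : ℕ) (a : ℕ → Hahn) (m : ℚ) (c : ℂ) (h : Hahn)
    (b : ℕ → Hahn) : Prop where
  zero : a 0 * h = -(HahnSeries.C c * b 0)
  succ : ∀ l < n, a (l + 1) * phiPow p (l + 1) h =
    b l * zpw ((p : ℚ) ^ l * (((p : ℚ) - 1) * m)) - HahnSeries.C c * b (l + 1)
  last : b n = 0

variable {p} {n : ℕ} {a b : ℕ → Hahn}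

theorem initPoly_coeff (μ w : ℚ) (l : ℕ) : (initPoly p n a μ w).coeff l =
    if l ≤ n then (a l).coeff (w + (p : ℚ) ^ l * μ) else 0 := by
  simp [initPoly, coeff_monomial]

theorem initPoly_coeff_of_le (μ w : ℚ) {l : ℕ} (hl : l ≤ n) :
    (initPoly p n a μ w).coeff l = (a l).coeff (w + (p : ℚ) ^ l * μ) := by
  rw [initPoly_coeff, if_pos hl]

theorem mem_of_isRoot {S : Multiset (ℚ × ℂ)} (hS : HasExponents p n a S) {μ w : ℚ}
    (hB : AboveLine p n a μ w) (h0 : initPoly p n a μ w ≠ 0) {c : ℂ} (hc : c ≠ 0)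
    (hr : (initPoly p n a μ w).IsRoot c) : (μ, c) ∈ S := by
  have h : c ∈ (initPoly p n a μ w).roots.filter (fun c => c ≠ 0) :=
    Multiset.mem_filter.2 ⟨(mem_roots h0).2 hr, hc⟩
  rw [hS μ w hB h0, Multiset.mem_map] at h
  obtain ⟨⟨x, y⟩, hx, rfl⟩ := h
  rw [Multiset.mem_filter] at hx
  obtain ⟨h1, rfl⟩ := hx
  exact h1

theorem isRoot_of_mem {S : Multiset (ℚ × ℂ)} (hS : HasExponents p n a S) {μ w : ℚ}
    (hB : AboveLine p n a μ w) (h0 : initPoly p n a μ w ≠ 0) {c : ℂ} (h : (μ, c) ∈ S) :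
    c ≠ 0 ∧ (initPoly p n a μ w).IsRoot c := by
  have h1 : c ∈ (S.filter (fun x => x.1 = μ)).map Prod.snd :=
    Multiset.mem_map.2 ⟨_, Multiset.mem_filter.2 ⟨h, rfl⟩, rfl⟩
  rw [← hS μ w hB h0, Multiset.mem_filter] at h1
  exact ⟨h1.2, (mem_roots h0).1 h1.1⟩

theorem exists_ne_zero_isRoot {P : ℂ[X]} (h0 : P.coeff 0 ≠ 0) {l : ℕ} (hl : l ≠ 0)
    (h : P.coeff l ≠ 0) : ∃ c, c ≠ 0 ∧ P.IsRoot c := by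
  have hd : P.degree ≠ 0 := by
    intro hd
    refine h (coeff_eq_zero_of_degree_lt ?_)
    rw [hd]
    exact_mod_cast Nat.pos_of_ne_zero hl
  obtain ⟨c, hc⟩ := IsAlgClosed.exists_root P hd
  refine ⟨c, ?_, hc⟩
  rintro rfl
  rw [IsRoot, ← coeff_zero_eq_eval_zero] at hc
  exact h0 hc

section

variable [p.AtLeastTwo]

theorem one_lt_pow {l : ℕ} (hl : l ≠ 0) : (1 : ℚ) < (p : ℚ) ^ l := one_lt_pow₀ (one_lt_p p) hl

/-- If some `a l` with `l ≥ 1` is nonzero, there is a first slope. -/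
theorem exists_first_slope {S : Multiset (ℚ × ℂ)} (hS : HasExponents p n a S) (ha0 : a 0 ≠ 0)
    (ha : ∃ l ≤ n, l ≠ 0 ∧ a l ≠ 0) :
    ∃ x ∈ S, AboveLine p n a x.1 ((a 0).order - x.1) := by
  classical
  let s := (Finset.range (n + 1)).filter fun l => l ≠ 0 ∧ a l ≠ 0
  have hs : ∀ l, l ∈ s ↔ l ≤ n ∧ l ≠ 0 ∧ a l ≠ 0 := by intro l; simp [s]
  -- The first edge minimizes the slope of the segments joining the point of index `0` to the
  -- others. Its line meets two points, so the initial polynomial has a nonzero root.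
  obtain ⟨l, hl, hmin⟩ := s.exists_min_image
    (fun l => ((a l).order - (a 0).order) / ((p : ℚ) ^ l - 1))
    (by obtain ⟨l, hl⟩ := ha; exact ⟨l, (hs l).2 hl⟩)
  set μ := ((a l).order - (a 0).order) / ((p : ℚ) ^ l - 1) with hμ
  rw [hs] at hl
  obtain ⟨hln, hl0, hal⟩ := hl
  have hB : AboveLine p n a μ ((a 0).order - μ) := by
    intro i hi
    by_cases hi0 : i = 0
    · subst hi0
      simpa using ordGE_order (a 0)
    by_cases hai : a i = 0
    · rw [hai]; exact ordGE_zero _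
    have h := hmin i ((hs i).2 ⟨hi, hi0, hai⟩)
    have hp := one_lt_pow (p := p) hi0
    rw [le_div_iff₀ (by linarith)] at h
    rw [ordGE_iff_order hai]
    linarith
  have hc0 : (initPoly p n a μ ((a 0).order - μ)).coeff 0 ≠ 0 := by
    rw [initPoly_coeff_of_le _ _ (Nat.zero_le n), pow_zero, one_mul, sub_add_cancel]
    exact HahnSeries.coeff_order_eq_zero.not.2 ha0
  have hcl : (initPoly p n a μ ((a 0).order - μ)).coeff l ≠ 0 := by
    have hp := one_lt_pow (p := p) hl0
    have h : (a 0).order - μ + (p : ℚ) ^ l * μ = (a l).order := by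
      have : μ * ((p : ℚ) ^ l - 1) = (a l).order - (a 0).order := by
        rw [hμ, div_mul_cancel₀]
        linarith
      linarith
    rw [initPoly_coeff_of_le _ _ hln, h]
    exact HahnSeries.coeff_order_eq_zero.not.2 hal
  obtain ⟨c, hc, hr⟩ := exists_ne_zero_isRoot hc0 hl0 hcl
  exact ⟨(μ, c), mem_of_isRoot hS hB (fun h => hc0 (by rw [h, coeff_zero])) hc hr, hB⟩

/-- The line is rotated downwards about the point `(1, val (a 0))`; all the points have abscissa
`p^l ≥ 1`. -/
theorem AboveLine.of_le {μ m w : ℚ} (h : AboveLine p n a μ ((a 0).order - μ)) (hm : m ≤ μ)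
    (hw : w = (a 0).order - m) : AboveLine p n a m w := by
  intro l hl
  refine (h l hl).mono ?_
  have : (1 : ℚ) ≤ (p : ℚ) ^ l := one_le_pow₀ (one_lt_p p).le
  nlinarith

/-- At equal ordinate at the origin and positive abscissae, the line of smaller slope is strictly
below the other, so it meets no point. -/
theorem initPoly_eq_zero {μ ρ w : ℚ} (h : AboveLine p n a ρ w) (hμ : μ < ρ) :
    initPoly p n a μ w = 0 := by
  ext l
  rw [initPoly_coeff, coeff_zero]
  split_ifs with hl
  · refine h l hl _ ?_
    have := mul_lt_mul_of_pos_left hμ (pow_pos (p_pos p) l)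
    linarith
  · rfl

/-- Multiplication by a series tangent to the identity does not change coefficients on the line. The
shift by `z^(p^l (p-1) m)` and by one index turns `w + p^(l+1) μ` into `w + p^l (p μ - (p-1) m)`,
the line of the other slope with the same `w`. -/
theorem IsQuotient.aboveLine {m : ℚ} {c : ℂ} {h : Hahn} (hq : IsQuotient p n a m c h b)
    (hh : TangentToId h) {μ ρ w : ℚ} (hB : AboveLine p n b ρ w) (h1 : μ ≤ ρ)
    (h2 : p * μ - (p - 1) * m ≤ ρ) :
    AboveLine p n a μ w ∧ initPoly p n a μ w =
      X * initPoly p n b (p * μ - (p - 1) * m) w - C c * initPoly p n b μ w := by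
  have hb : ∀ l ≤ n, OrdGE (HahnSeries.C c * b l) (w + (p : ℚ) ^ l * μ) := by
    intro l hl γ hγ
    rw [coeff_C_mul, hB l hl, mul_zero]
    have := mul_le_mul_of_nonneg_left h1 (pow_pos (p_pos p) l).le
    linarith
  have hA : AboveLine p n a μ w := by
    intro l hl
    cases l with
    | zero =>
      rw [← hh.ordGE_mul_iff, hq.zero]
      exact (hb 0 hl).neg
    | succ l =>
      rw [← (hh.phiPow (p := p) (l + 1)).ordGE_mul_iff, hq.succ l hl, sub_eq_add_neg]
      refine OrdGE.add ?_ (hb _ hl).neg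
      intro γ hγ
      rw [coeff_mul_zpw]
      refine hB l (by omega) _ ?_
      have := mul_le_mul_of_nonneg_left h2 (pow_pos (p_pos p) l).le
      rw [pow_succ] at hγ
      linarith
  refine ⟨hA, ?_⟩
  ext l
  rw [coeff_sub, Polynomial.coeff_C_mul]
  cases l with
  | zero =>
    rw [mul_coeff_zero, coeff_X_zero, zero_mul, zero_sub, initPoly_coeff_of_le _ _ (Nat.zero_le n),
      initPoly_coeff_of_le _ _ (Nat.zero_le n), ← hh.coeff_mul (hA 0 (Nat.zero_le n)), hq.zero,
      HahnSeries.coeff_neg, coeff_C_mul]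
  | succ l =>
    rw [coeff_X_mul]
    by_cases hl : l + 1 ≤ n
    · rw [initPoly_coeff_of_le _ _ hl, initPoly_coeff_of_le _ _ hl, initPoly_coeff_of_le _ _
        (by omega : l ≤ n), ← (hh.phiPow (p := p) (l + 1)).coeff_mul (hA _ hl), hq.succ l hl,
        HahnSeries.coeff_sub, coeff_C_mul, coeff_mul_zpw]
      congr 2
      ring
    · rw [initPoly_coeff, initPoly_coeff, initPoly_coeff, if_neg hl, if_neg hl, mul_zero, sub_zero]
      split_ifs with hl'
      · rw [show l = n by omega, hq.last, HahnSeries.coeff_zero]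
      · rfl

theorem roots_neg_C_mul {c : ℂ} (hc : c ≠ 0) (P : ℂ[X]) : (-(C c * P)).roots = P.roots := by
  rw [roots_neg, roots_C_mul _ hc]

/-- The effect of the division by a first order factor on slopes and exponents. -/
def shiftSlope (p : ℕ) (m : ℚ) (x : ℚ × ℂ) : ℚ × ℂ := (p * (x.1 - m) + m, x.2)

/-- In the relation of `IsQuotient.aboveLine` one term vanishes unless the slope is `m`: below `m`
only `-c` times the polynomial of `b` survives, above `m` only `X` times it, and neither changes the
nonzero roots. At `m` itself the factor `X - c` appears and accounts for the pair `(m, c)` removed.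
-/
theorem IsQuotient.hasExponents {m : ℚ} {c : ℂ} {h : Hahn} (hq : IsQuotient p n a m c h b)
    (hh : TangentToId h) (hc : c ≠ 0) {S : Multiset (ℚ × ℂ)} (hS : HasExponents p n a ((m, c) ::ₘ S))
    (hm : ∀ x ∈ S, m ≤ x.1) : HasExponents p n b (S.map (shiftSlope p m)) := by
  intro ρ w hB h0
  have hp := one_lt_p p
  have hp0 := p_pos p
  rw [Multiset.filter_map, Multiset.map_map]
  have hcomp : Prod.snd ∘ shiftSlope p m = Prod.snd := rfl
  rw [hcomp]
  rcases lt_trichotomy ρ m with h | h | h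
  · have hlt : p * ρ - (p - 1) * m < ρ := by nlinarith
    obtain ⟨hA, hP⟩ := hq.aboveLine hh hB le_rfl hlt.le
    rw [initPoly_eq_zero hB hlt, mul_zero, zero_sub] at hP
    have h1 := hS ρ w hA (by rw [hP]; exact neg_ne_zero.2 (mul_ne_zero (C_ne_zero.2 hc) h0))
    rw [hP, roots_neg_C_mul hc] at h1
    rw [h1, Multiset.filter_cons_of_neg (p := fun x : ℚ × ℂ => x.1 = ρ) S h.ne', Multiset.filter_eq_nil.2, Multiset.filter_eq_nil.2]
    · intro x hx
      have := hm x hx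
      simp only [Function.comp, shiftSlope]
      nlinarith
    · intro x hx
      have := hm x hx
      linarith
  · subst h
    have he : p * ρ - (p - 1) * ρ = ρ := by ring
    obtain ⟨hA, hP⟩ := hq.aboveLine hh hB le_rfl he.le
    rw [he, ← sub_mul] at hP
    have hne : (X - C c) * initPoly p n b ρ w ≠ 0 := mul_ne_zero (X_sub_C_ne_zero c) h0
    have h1 := hS ρ w hA (by rw [hP]; exact hne)
    rw [hP, roots_mul hne, roots_X_sub_C, Multiset.singleton_add, Multiset.filter_cons_of_pos (p := fun c : ℂ => c ≠ 0) _ hc,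
      Multiset.filter_cons_of_pos (p := fun x : ℚ × ℂ => x.1 = ρ) S rfl, Multiset.map_cons,
      Multiset.cons_inj_right] at h1
    rw [h1]
    congr 1
    refine Multiset.filter_congr fun x _ => ?_
    simp only [Function.comp, shiftSlope]
    constructor
    · intro h; rw [h]; ring
    · intro h
      have : (p : ℚ) * (x.1 - ρ) = 0 := by linarith
      rcases mul_eq_zero.1 this with h | h
      · exact absurd h hp0.ne'
      · linarith
  -- The slope that `shiftSlope` sends to `ρ`.
  · set μ := (ρ + (p - 1) * m) / p with hμ
    have hμp : p * μ = ρ + (p - 1) * m := by rw [hμ, mul_div_cancel₀ _ hp0.ne']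
    have hlt : μ < ρ := by nlinarith
    have hmμ : m < μ := by nlinarith
    have he : p * μ - (p - 1) * m = ρ := by linarith
    obtain ⟨hA, hP⟩ := hq.aboveLine hh hB hlt.le he.le
    rw [he, initPoly_eq_zero hB hlt, mul_zero, sub_zero] at hP
    have hne : X * initPoly p n b ρ w ≠ 0 := mul_ne_zero X_ne_zero h0
    have h1 := hS μ w hA (by rw [hP]; exact hne)
    rw [hP, roots_mul hne, roots_X, Multiset.singleton_add,
      Multiset.filter_cons_of_neg (p := fun c : ℂ => c ≠ 0) _ (not_not.2 rfl),
      Multiset.filter_cons_of_neg (p := fun x : ℚ × ℂ => x.1 = μ) S hmμ.ne] at h1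
    rw [h1]
    congr 1
    refine Multiset.filter_congr fun x _ => ?_
    simp only [Function.comp, shiftSlope]
    constructor
    · intro h; rw [h]; linarith
    · intro h
      have : (p : ℚ) * x.1 = p * μ := by linarith
      exact mul_left_cancel₀ hp0.ne' this

theorem IsQuotient.leading {m : ℚ} {c : ℂ} {h : Hahn} (hq : IsQuotient p n a m c h b)
    (hh : TangentToId h) (hc : c ≠ 0) (ha0 : a 0 ≠ 0) : b 0 ≠ 0 ∧
    (b 0).orderTop = (a 0).orderTop ∧ (b 0).leadingCoeff = (-c)⁻¹ * (a 0).leadingCoeff := by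
  have h1 : a 0 * h = HahnSeries.single 0 (-c) * b 0 := by
    rw [← HahnSeries.C_apply, map_neg, hq.zero]
    ring
  have hc' : -c ≠ 0 := neg_ne_zero.2 hc
  refine ⟨?_, ?_, ?_⟩
  · intro hb
    rw [hb, mul_zero] at h1
    exact mul_ne_zero ha0 hh.1 h1
  · have := congrArg HahnSeries.orderTop h1
    rw [HahnSeries.orderTop_mul, HahnSeries.orderTop_mul, hh.2.1, HahnSeries.orderTop_single hc',
      WithTop.coe_zero, zero_add, add_zero] at this
    exact this.symm
  · have := congrArg HahnSeries.leadingCoeff h1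
    rw [HahnSeries.leadingCoeff_mul, HahnSeries.leadingCoeff_mul, hh.2.2,
      HahnSeries.leadingCoeff_of_single, mul_one] at this
    rw [this, inv_mul_cancel_left₀ hc']

/-- Division by a first order factor attached to the smallest slope. -/
theorem exists_isQuotient {m : ℚ} {c : ℂ} {S : Multiset (ℚ × ℂ)} (ha0 : a 0 ≠ 0)
    (hS : HasExponents p n a ((m, c) ::ₘ S)) (hm : ∀ x ∈ S, m ≤ x.1) :
    ∃ h b, TangentToId h ∧ c ≠ 0 ∧ IsQuotient p n a m c h b := by
  -- The line of slope `m` through `(1, val (a 0))`. By minimality of `m` it lies below all the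
  -- points.
  obtain ⟨w, hw⟩ : ∃ w, w = (a 0).order - m := ⟨_, rfl⟩
  have hw0 : w + (p : ℚ) ^ 0 * m = (a 0).order := by rw [hw]; ring
  have hlc : (a 0).coeff (a 0).order ≠ 0 := HahnSeries.coeff_order_eq_zero.not.2 ha0
  have hA : AboveLine p n a m w := by
    by_cases ha : ∃ l ≤ n, l ≠ 0 ∧ a l ≠ 0
    · obtain ⟨x, hx, hB⟩ := exists_first_slope hS ha0 ha
      refine hB.of_le ?_ hw
      rcases Multiset.mem_cons.1 hx with rfl | hx
      · exact le_rfl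
      · exact hm x hx
    · push Not at ha
      intro l hl
      by_cases hl0 : l = 0
      · rw [hl0, hw0]
        exact ordGE_order _
      · rw [ha l hl hl0]
        exact ordGE_zero _
  have hP0 : initPoly p n a m w ≠ 0 := by
    intro h
    have := congrArg (coeff · 0) h
    simp only [initPoly_coeff_of_le _ _ (Nat.zero_le n), hw0, coeff_zero] at this
    exact hlc this
  obtain ⟨hc, hr⟩ := isRoot_of_mem hS hA hP0 (Multiset.mem_cons_self (m, c) S)
  -- This is `φ^l` applied to `z^(-m) e_c`, with the common symbol `e_c` dropped.
  let y : ℕ → Hahn := fun l => HahnSeries.C (c ^ l) * zpw (-((p : ℚ) ^ l * m))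
  have hy0 : ∀ l, y l ≠ 0 := fun l =>
    mul_ne_zero (HahnSeries.C_ne_zero (pow_ne_zero l hc)) (zpw_ne_zero _)
  have hys : ∀ l, y l = zpw ((p : ℚ) ^ l * ((p - 1) * m)) * (HahnSeries.C c)⁻¹ * y (l + 1) := by
    intro l
    have hC : (HahnSeries.C c : Hahn) ≠ 0 := HahnSeries.C_ne_zero hc
    have h1 : -((p : ℚ) ^ l * m) = (p : ℚ) ^ l * ((p - 1) * m) + -((p : ℚ) ^ (l + 1) * m) := by ring
    simp only [y]
    rw [h1, zpw_add, pow_succ c, map_mul]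
    field_simp
  have hcoef : ∀ l γ, (a l * y l * zpw (-w)).coeff γ =
      c ^ l * (a l).coeff (γ + (w + (p : ℚ) ^ l * m)) := by
    intro l γ
    simp only [y]
    rw [coeff_mul_zpw, mul_left_comm, coeff_C_mul, coeff_mul_zpw]
    congr 2
    ring
  obtain ⟨h, hh, hsol⟩ := exists_tangent_solution p n (fun l => a l * y l * zpw (-w))
    (fun l hl γ hγ => by rw [hcoef, hA l hl _ (by linarith), mul_zero])
    (by rw [hcoef, zero_add, hw0]; exact mul_ne_zero (pow_ne_zero 0 hc) hlc)
    (by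
      rw [IsRoot, initPoly, eval_finsetSum] at hr
      rw [← hr]
      refine Finset.sum_congr rfl fun l _ => ?_
      rw [hcoef, eval_monomial, zero_add, mul_comm])
  -- The recurrence for the quotient telescopes: its coefficients are, up to `-c⁻¹ (y l)⁻¹`, the
  -- partial sums of the equation for `h`, and `b n = 0` is that equation.
  let s : ℕ → Hahn := fun l => ∑ i ∈ Finset.range (l + 1), a i * y i * phiPow p i h
  have hsn : s n = 0 := by
    have h1 : s n * zpw (-w) = 0 := by
      rw [← hsol, Finset.sum_mul]
      exact Finset.sum_congr rfl fun l _ => by ring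
    exact (mul_eq_zero.1 h1).resolve_right (zpw_ne_zero _)
  have hC : (HahnSeries.C c : Hahn) ≠ 0 := HahnSeries.C_ne_zero hc
  refine ⟨h, fun l => -((HahnSeries.C c)⁻¹ * (y l)⁻¹ * s l), hh, hc, ⟨?_, fun l hl => ?_, ?_⟩⟩
  · have : s 0 = a 0 * y 0 * h := by simp [s, phiPow_zero]
    have := hy0 0
    simp only [‹s 0 = _›]
    field_simp
  · have h1 : s (l + 1) = s l + a (l + 1) * y (l + 1) * phiPow p (l + 1) h :=
      Finset.sum_range_succ _ _
    have h2 := hy0 (l + 1)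
    have h3 := zpw_ne_zero ((p : ℚ) ^ l * ((p - 1) * m))
    simp only [h1, hys l]
    generalize zpw ((p : ℚ) ^ l * ((p - 1) * m)) = Z at h3 ⊢
    field_simp
    ring
  · simp only [hsn, mul_zero, neg_zero]

end

end Mahler

/-! ### The Ore algebra and the induction on slopes -/

namespace Mahler
open Polynomial

section

variable (p : ℕ) [p.AtLeastTwo]

theorem Op.const_mul (f g : Hahn) : Op.const p (f * g) = Op.const p f * Op.const p g := by
  let _ := zAction p
  have h := SkewMonoidAlgebra.single_mul_single (k := Hahn) (G := Multiplicative ℤ)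
    (a₁ := 1) (a₂ := 1) (b₁ := f) (b₂ := g)
  refine Eq.trans ?_ h.symm
  rw [one_smul, mul_one]
  rfl

/-- The embedding of the field of Hahn series into the Ore algebra. -/
noncomputable def Op.constHom : Hahn →+* Op p where
  toFun := Op.const p
  map_one' := rfl
  map_mul' := Op.const_mul p
  map_zero' := SkewMonoidAlgebra.single_zero_right (k := Hahn) (G := Multiplicative ℤ) 1
  map_add' := SkewMonoidAlgebra.single_add (k := Hahn) (G := Multiplicative ℤ) 1

theorem Op.constHom_apply (f : Hahn) : Op.constHom p f = Op.const p f := rfl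

theorem Op.Phi_pow_mul_const (l : ℕ) (f : Hahn) :
    Op.Phi p ^ l * Op.const p f = Op.const p (phiPow p l f) * Op.Phi p ^ l := by
  induction l with
  | zero => rw [pow_zero, one_mul, mul_one, phiPow_zero]
  | succ l ih =>
    rw [pow_succ', mul_assoc, ih, ← mul_assoc, Op.Phi_mul_const, phi_phiPow, mul_assoc]

theorem Op.Phi_pow (l : ℕ) : Op.Phi p ^ l =
    (SkewMonoidAlgebra.single (Multiplicative.ofAdd (l : ℤ)) 1 :
      SkewMonoidAlgebra Hahn (Multiplicative ℤ)) := by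
  induction l with
  | zero => rfl
  | succ l ih =>
    let _ := zAction p
    have h := SkewMonoidAlgebra.single_mul_single (k := Hahn) (G := Multiplicative ℤ)
      (a₁ := Multiplicative.ofAdd (l : ℤ)) (a₂ := Multiplicative.ofAdd 1) (b₁ := 1) (b₂ := 1)
    rw [pow_succ, ih]
    refine h.trans ?_
    rw [smul_one, mul_one]
    rfl

theorem Op.const_mul_Phi_pow (f : Hahn) (l : ℕ) : Op.const p f * Op.Phi p ^ l =
    (SkewMonoidAlgebra.single (Multiplicative.ofAdd (l : ℤ)) f :
      SkewMonoidAlgebra Hahn (Multiplicative ℤ)) := by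
  let _ := zAction p
  have h := SkewMonoidAlgebra.single_mul_single (k := Hahn) (G := Multiplicative ℤ)
    (a₁ := 1) (a₂ := Multiplicative.ofAdd (l : ℤ)) (b₁ := f) (b₂ := 1)
  rw [Op.Phi_pow]
  refine h.trans ?_
  rw [one_smul, one_mul, mul_one]

/-- The operator `∑ a l φ ^ l`, `l ≤ n`. -/
noncomputable def opOf (n : ℕ) (a : ℕ → Hahn) : Op p :=
  ∑ l ∈ Finset.range (n + 1), Op.const p (a l) * Op.Phi p ^ l

theorem opOf_mul_const (n : ℕ) (a : ℕ → Hahn) (f : Hahn) :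
    opOf p n a * Op.const p f = opOf p n (fun l => a l * phiPow p l f) := by
  rw [opOf, opOf, Finset.sum_mul]
  refine Finset.sum_congr rfl fun l _ => ?_
  rw [mul_assoc, Op.Phi_pow_mul_const, ← mul_assoc, Op.const_mul]

theorem const_mul_opOf (n : ℕ) (a : ℕ → Hahn) (f : Hahn) :
    Op.const p f * opOf p n a = opOf p n (fun l => f * a l) := by
  rw [opOf, opOf, Finset.mul_sum]
  refine Finset.sum_congr rfl fun l _ => ?_
  rw [← mul_assoc, Op.const_mul]

end

variable {p : ℕ} [p.AtLeastTwo] {n : ℕ} {a b : ℕ → Hahn}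

theorem IsQuotient.opOf_eq {m : ℚ} {c : ℂ} {h : Hahn} (hq : IsQuotient p n a m c h b)
    (hh : TangentToId h) : opOf p n a = opOf p n b * linFactor p ((p - 1) * m) c h := by
  have key : opOf p n a * Op.const p h = opOf p n b *
      (Op.const p (zpw ((p - 1) * m)) * Op.Phi p - Op.const p (HahnSeries.C c)) := by
    rw [mul_sub, ← mul_assoc, opOf_mul_const, opOf_mul_const, opOf_mul_const]
    simp only [phiPow_zpw, phiPow_C, mul_comm _ (HahnSeries.C c)]
    -- The product by `φ` raises degrees by one, so its top term is split off and vanishes by `b n =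
    -- 0`, while the constant terms are split off from the other two sums.
    rw [opOf, opOf, opOf, Finset.sum_range_succ', Finset.sum_range_succ _ n,
      Finset.sum_range_succ' (fun l => Op.const p (HahnSeries.C c * b l) * Op.Phi p ^ l)]
    simp only [phiPow_zero, pow_zero, mul_one, hq.zero, hq.last, zero_mul, ← Op.constHom_apply,
      map_zero, add_zero, map_neg]
    rw [← sub_sub, ← sub_eq_add_neg, Finset.sum_mul, ← Finset.sum_sub_distrib]
    congr 1
    refine Finset.sum_congr rfl fun l hl => ?_
    rw [hq.succ l (Finset.mem_range.1 hl), map_sub, sub_mul, mul_assoc _ (Op.Phi p ^ l), ← pow_succ]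
  have h1 : Op.const p h * Op.const p h⁻¹ = 1 := by
    rw [← Op.const_mul, mul_inv_cancel₀ hh.1]
    rfl
  rw [linFactor, ← mul_assoc, ← key, mul_assoc, h1, mul_one]

theorem descProd_succ {R : Type*} [Monoid R] {m : ℕ} (x : Fin (m + 1) → R) :
    descProd x = descProd (fun i => x i.succ) * x 0 := by
  simp [descProd, List.ofFn_succ]

/-- Division by all the first order factors attached to the smallest slope. -/
theorem exists_block (m : ℚ) (r : ℕ) : ∀ (a : ℕ → Hahn) (c : Fin r → ℂ) (S : Multiset (ℚ × ℂ)),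
    a 0 ≠ 0 → HasExponents p n a ((List.ofFn fun j => (m, c j) : List (ℚ × ℂ)) + S) →
    (∀ x ∈ S, m ≤ x.1) →
    ∃ (b : ℕ → Hahn) (h : Fin r → Hahn), b 0 ≠ 0 ∧ (b 0).orderTop = (a 0).orderTop ∧
      (b 0).leadingCoeff = (∏ j, (-(c j))⁻¹) * (a 0).leadingCoeff ∧
      (∀ j, TangentToId (h j)) ∧
      opOf p n a = opOf p n b * descProd (fun j => linFactor p ((p - 1) * m) (c j) (h j)) ∧
      HasExponents p n b (S.map fun x => ((p : ℚ) ^ r * (x.1 - m) + m, x.2)) := by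
  induction r with
  | zero =>
    intro a c S ha hS _
    refine ⟨a, Fin.elim0, ha, rfl, by simp, fun j => j.elim0, by simp [descProd], ?_⟩
    simpa using hS
  | succ r ih =>
    intro a c S ha hS hm
    rw [List.ofFn_succ, ← Multiset.cons_coe, Multiset.cons_add] at hS
    have hm' : ∀ x ∈ ((List.ofFn fun j : Fin r => (m, c j.succ) : List (ℚ × ℂ)) : Multiset _) + S,
        m ≤ x.1 := by
      intro x hx
      rcases Multiset.mem_add.1 hx with hx | hx
      · rw [Multiset.mem_coe, List.mem_ofFn] at hx
        obtain ⟨j, rfl⟩ := hx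
        exact le_rfl
      · exact hm x hx
    obtain ⟨h, b, hh, hc, hq⟩ := exists_isQuotient ha hS hm'
    obtain ⟨hb0, hbo, hbl⟩ := hq.leading hh hc ha
    have hE := hq.hasExponents hh hc hS hm'
    have hp := one_lt_p p
    rw [Multiset.map_add, Multiset.map_coe, List.map_ofFn] at hE
    -- The slope `m` is the fixed point of the shift, so the remaining exponents at `m` stay
    -- attached to `m`, with the same `ν`.
    have hfun : shiftSlope p m ∘ (fun j : Fin r => (m, c j.succ)) = fun j => (m, c j.succ) := by
      funext j
      simp [shiftSlope]
    rw [hfun] at hE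
    obtain ⟨b', h', hb0', hbo', hbl', hh', hfac, hE'⟩ := ih b (fun j => c j.succ) _ hb0 hE (by
      intro x hx
      obtain ⟨y, hy, rfl⟩ := Multiset.mem_map.1 hx
      have := hm y hy
      simp only [shiftSlope]
      nlinarith)
    refine ⟨b', Fin.cons h h', hb0', hbo'.trans hbo, ?_, ?_, ?_, ?_⟩
    · rw [hbl', hbl, Fin.prod_univ_succ]
      ring
    · intro j
      cases j using Fin.cases with
      | zero => exact hh
      | succ j => exact hh' j
    · rw [hq.opOf_eq hh, hfac, descProd_succ, mul_assoc]
      rfl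
    · rw [Multiset.map_map] at hE'
      convert hE' using 2
      simp only [Function.comp, shiftSlope]
      ext1
      · ring
      · rfl

theorem sum_Iic_eq {M : Type*} [AddCommMonoid M] {k : ℕ} (f : Fin k → M) (i : Fin k) :
    ∑ j ∈ Finset.Iic i, f j = ∑ j, if j ≤ i then f j else 0 := by
  rw [← Finset.sum_filter]
  congr 1
  ext j
  simp

theorem sum_Iio_eq {M : Type*} [AddCommMonoid M] {k : ℕ} (f : Fin k → M) (i : Fin k) :
    ∑ j ∈ Finset.Iio i, f j = ∑ j, if j < i then f j else 0 := by
  rw [← Finset.sum_filter]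
  congr 1
  ext j
  simp

theorem sum_Iio_succ {k : ℕ} (f : Fin (k + 1) → ℕ) (i : Fin k) :
    ∑ j ∈ Finset.Iio i.succ, f j = f 0 + ∑ j ∈ Finset.Iio i, f j.succ := by
  rw [sum_Iio_eq, sum_Iio_eq, Fin.sum_univ_succ, if_pos (Fin.succ_pos i)]
  simp only [Fin.succ_lt_succ_iff]

theorem nu_zero {p : ℕ} {k : ℕ} (μ : Fin (k + 1) → ℚ) (r : Fin (k + 1) → ℕ) :
    nu p μ r 0 = (p - 1) * μ 0 := by
  rw [nu, sum_Iic_eq, Fin.sum_univ_succ]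
  simp [sum_Iio_eq, prevSlope]

/-- The affine map `x ↦ p^(r 0) (x - μ 0) + μ 0` multiplies differences of slopes by `p^(r 0)`,
which supplies the missing `r 0` in the powers of `p`. The first new slope equals the sum of the
first two terms of the old one. -/
theorem nu_succ {p : ℕ} {k : ℕ} (μ : Fin (k + 1) → ℚ) (r : Fin (k + 1) → ℕ) (i : Fin k) :
    nu p μ r i.succ = nu p (fun j : Fin k => (p : ℚ) ^ r 0 * (μ j.succ - μ 0) + μ 0)
      (fun j => r j.succ) i := by
  obtain ⟨k, rfl⟩ : ∃ k', k = k' + 1 := ⟨k - 1, by have := i.2; omega⟩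
  have hterm : ∀ j : Fin k, prevSlope (fun j : Fin (k + 1) =>
      (p : ℚ) ^ r 0 * (μ j.succ - μ 0) + μ 0) j.succ =
      (p : ℚ) ^ r 0 * (prevSlope μ j.succ.succ - μ 0) + μ 0 := by
    intro j
    simp only [prevSlope, Fin.val_succ, Nat.succ_pos, if_true]
    rfl
  have h0 : prevSlope (fun j : Fin (k + 1) =>
      (p : ℚ) ^ r 0 * (μ j.succ - μ 0) + μ 0) 0 = 0 := rfl
  have h1 : prevSlope μ 0 = 0 := rfl
  have h2 : prevSlope μ (Fin.succ 0) = μ 0 := rfl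
  have hz : ∑ l ∈ Finset.Iio (0 : Fin (k + 1)), r l.succ = 0 := by simp [sum_Iio_eq]
  have hz' : ∑ l ∈ Finset.Iio (0 : Fin (k + 2)), r l = 0 := by simp [sum_Iio_eq]
  rw [nu, nu, sum_Iic_eq, sum_Iic_eq, Fin.sum_univ_succ, Fin.sum_univ_succ, Fin.sum_univ_succ]
  simp only [Fin.succ_le_succ_iff, Fin.zero_le, if_true, hterm, h0, h1, h2, hz, hz', sum_Iio_succ]
  rw [← add_assoc]
  congr 2
  · ring
  · refine Finset.sum_congr rfl fun j _ => ?_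
    split_ifs
    · ring
    · rfl

/-- The factorization, from the multiset of slopes and exponents. -/
theorem exists_factorization (k : ℕ) : ∀ (a : ℕ → Hahn) (μ : Fin k → ℚ) (r : Fin k → ℕ)
    (c : (i : Fin k) → Fin (r i) → ℂ), a 0 ≠ 0 → StrictMono μ →
    HasExponents p n a (∑ i, ((List.ofFn fun j => (μ i, c i j) : List (ℚ × ℂ)) : Multiset _)) →
    ∃ (b : Hahn) (h : (i : Fin k) → Fin (r i) → Hahn), b ≠ 0 ∧ b.orderTop = (a 0).orderTop ∧
      b.leadingCoeff = (∏ i, ∏ j, (-(c i j))⁻¹) * (a 0).leadingCoeff ∧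
      (∀ i j, TangentToId (h i j)) ∧
      opOf p n a = Op.const p b * descProd (fun i => descProd (fun j =>
        linFactor p (nu p μ r i) (c i j) (h i j))) := by
  induction k with
  | zero =>
    intro a μ r c ha _ hS
    refine ⟨a 0, fun i => i.elim0, ha, rfl, by simp, fun i => i.elim0, ?_⟩
    -- With no pair left there is no first slope, so the operator is reduced to its constant
    -- coefficient.
    have h0 : ∀ l ≤ n, l ≠ 0 → a l = 0 := by
      intro l hl hl0
      by_contra hal
      obtain ⟨x, hx, _⟩ := exists_first_slope hS ha ⟨l, hl, hl0, hal⟩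
      simp at hx
    rw [opOf, Finset.sum_eq_single 0]
    · simp [descProd]
    · intro l hl hl0
      rw [h0 l (by simpa [Nat.lt_succ_iff] using hl) hl0, ← Op.constHom_apply, map_zero, zero_mul]
    · simp
  | succ k ih =>
    intro a μ r c ha hμ hS
    rw [Fin.sum_univ_succ] at hS
    obtain ⟨b, h, hb0, hbo, hbl, hh, hfac, hE⟩ := exists_block (μ 0) (r 0) a (c 0) _ ha hS (by
      intro x hx
      obtain ⟨i, _, hx⟩ := Multiset.mem_sum.1 hx
      rw [Multiset.mem_coe, List.mem_ofFn] at hx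
      obtain ⟨j, rfl⟩ := hx
      exact hμ.monotone (Fin.zero_le _))
    rw [← Multiset.coe_mapAddMonoidHom, map_sum] at hE
    simp only [Multiset.coe_mapAddMonoidHom, Multiset.map_coe, List.map_ofFn] at hE
    obtain ⟨b', h', hb0', hbo', hbl', hh', hfac'⟩ := ih b
      (fun i => (p : ℚ) ^ r 0 * (μ i.succ - μ 0) + μ 0) (fun i => r i.succ) (fun i => c i.succ) hb0
      (by
        intro i j hij
        have h1 := hμ (Fin.succ_lt_succ_iff.2 hij)
        have h2 := pow_pos (p_pos p) (r 0)
        dsimp only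
        nlinarith) hE
    refine ⟨b', Fin.cons h h', hb0', hbo'.trans hbo, ?_, ?_, ?_⟩
    · rw [hbl', hbl, Fin.prod_univ_succ]
      ring
    · intro i
      cases i using Fin.cases with
      | zero => exact hh
      | succ i => exact hh' i
    · rw [hfac, hfac', descProd_succ, mul_assoc]
      simp only [nu_succ, nu_zero, Fin.cons_zero, Fin.cons_succ]

end Mahler

/-! ### Characteristic polynomials as initial polynomials -/

namespace Mahler
open Polynomial

variable {p : ℕ} [p.AtLeastTwo] {n : ℕ} {a : ℕ → Hahn}

theorem coef_opOf (i : ℤ) : (opOf p n a).coef i =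
    ∑ l ∈ Finset.range (n + 1), if (l : ℤ) = i then a l else 0 := by
  let f : Op p →+ Hahn :=
    { toFun := fun L => L.coef i
      map_zero' := rfl
      map_add' := fun x y => DFunLike.congr_fun (SkewMonoidAlgebra.coeff_add (k := Hahn)
        (G := Multiplicative ℤ) x y) (Multiplicative.ofAdd i) }
  have hf : ∀ L : Op p, f L = L.coef i := fun _ => rfl
  rw [← hf, opOf, map_sum]
  refine Finset.sum_congr rfl fun l _ => ?_
  rw [hf, Op.const_mul_Phi_pow]
  exact SkewMonoidAlgebra.coeff_single_apply (k := Hahn)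
    (a := Multiplicative.ofAdd (l : ℤ)) (a' := Multiplicative.ofAdd i)

theorem coef_opOf_natCast {l : ℕ} (hl : l ≤ n) : (opOf p n a).coef l = a l := by
  rw [coef_opOf, Finset.sum_eq_single l]
  · simp
  · intro i _ hi
    rw [if_neg (by exact_mod_cast hi)]
  · intro h
    exact absurd (Finset.mem_range.2 (Nat.lt_succ_of_le hl)) h

theorem exists_of_coef_ne_zero {i : ℤ} (h : (opOf p n a).coef i ≠ 0) : ∃ l ≤ n, i = (l : ℤ) := by
  rw [coef_opOf] at h
  obtain ⟨l, hl, h⟩ := Finset.exists_ne_zero_of_sum_ne_zero h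
  refine ⟨l, Nat.lt_succ_iff.1 (Finset.mem_range.1 hl), ?_⟩
  by_contra hne
  exact h (if_neg fun h' => hne h'.symm)

theorem theta_eq (μ : ℚ) : Op.theta p (-((p : ℚ) - 1) * μ) = zpw (-μ) := by
  have := one_lt_p p
  rw [Op.theta]
  congr 1
  rw [div_eq_iff (by linarith)]
  ring

theorem gauge_opOf (μ : ℚ) : (opOf p n a).gauge (Op.theta p (-((p : ℚ) - 1) * μ)) =
    opOf p n (fun l => zpw μ * a l * zpw (-((p : ℚ) ^ l * μ))) := by
  rw [Op.gauge, theta_eq, zpw_inv, neg_neg, const_mul_opOf, opOf_mul_const]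
  simp only [phiPow_zpw, mul_neg]

theorem coeff_gauge {p : ℕ} (l : ℕ) (f : Hahn) (μ γ : ℚ) :
    (zpw μ * f * zpw (-((p : ℚ) ^ l * μ))).coeff γ = f.coeff (γ + (p : ℚ) ^ l * μ - μ) := by
  rw [coeff_mul_zpw, coeff_zpw_mul, sub_neg_eq_add]

theorem exists_coeff_ne_zero {p : ℕ} {μ w : ℚ} (h0 : initPoly p n a μ w ≠ 0) :
    ∃ l ≤ n, (a l).coeff (w + (p : ℚ) ^ l * μ) ≠ 0 := by
  by_contra h
  push Not at h
  refine h0 ?_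
  ext l
  rw [initPoly_coeff, coeff_zero]
  split_ifs with hl
  · exact h l hl
  · rfl

/-- The gauge transform shears the line of slope `μ` into a horizontal one, of height its ordinate
`w + μ` at abscissa `1`. -/
theorem val_gauge {μ w : ℚ} (hB : AboveLine p n a μ w) (h0 : initPoly p n a μ w ≠ 0) :
    ((opOf p n a).gauge (Op.theta p (-((p : ℚ) - 1) * μ))).val = w + μ := by
  rw [gauge_opOf, Op.val]
  set M := opOf p n (fun l => zpw μ * a l * zpw (-((p : ℚ) ^ l * μ))) with hM
  have : M.supp.inf (fun i => (M.coef i).orderTop) = ((w + μ : ℚ) : WithTop ℚ) := by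
    refine le_antisymm ?_ (Finset.le_inf fun i hi => ?_)
    · obtain ⟨l, hl, h⟩ := exists_coeff_ne_zero h0
      have h1 : (M.coef l).coeff (w + μ) ≠ 0 := by
        rw [hM, coef_opOf_natCast hl, coeff_gauge]
        rwa [show w + μ + (p : ℚ) ^ l * μ - μ = w + (p : ℚ) ^ l * μ by ring]
      have h2 : (l : ℤ) ∈ M.supp := by
        rw [Op.mem_supp]
        intro h
        rw [h] at h1
        exact h1 rfl
      exact (Finset.inf_le h2).trans (HahnSeries.orderTop_le_of_coeff_ne_zero h1)
    · rw [Op.mem_supp] at hi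
      obtain ⟨l, hl, rfl⟩ := exists_of_coef_ne_zero hi
      rw [← ordGE_iff, hM, coef_opOf_natCast hl]
      intro γ hγ
      rw [coeff_gauge]
      exact hB l hl _ (by linarith)
  rw [this]
  rfl

theorem charPoly_opOf {μ w : ℚ} (hB : AboveLine p n a μ w) (h0 : initPoly p n a μ w ≠ 0) :
    (opOf p n a).charPoly μ = initPoly p n a μ w := by
  have hv := val_gauge hB h0
  rw [Op.charPoly]
  simp only [hv]
  rw [gauge_opOf]
  set M := opOf p n (fun l => zpw μ * a l * zpw (-((p : ℚ) ^ l * μ))) with hM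
  have hsub : M.supp ⊆ (Finset.range (n + 1)).map Nat.castEmbedding := by
    intro i hi
    rw [Op.mem_supp] at hi
    obtain ⟨l, hl, rfl⟩ := exists_of_coef_ne_zero hi
    exact Finset.mem_map.2 ⟨l, Finset.mem_range.2 (Nat.lt_succ_of_le hl), rfl⟩
  rw [Finset.sum_subset hsub, Finset.sum_map, initPoly]
  · refine Finset.sum_congr rfl fun l hl => ?_
    rw [Nat.castEmbedding_apply, Int.toNat_natCast, coeff_zpw_mul, hM,
      coef_opOf_natCast (Nat.lt_succ_iff.1 (Finset.mem_range.1 hl)), coeff_gauge]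
    congr 2
    ring
  · intro i _ hi
    rw [Op.mem_supp, not_not] at hi
    rw [hi, mul_zero, HahnSeries.coeff_zero, monomial_zero_right]

/-! ### Vertices of the Newton polygon -/

/-- The points above the line `y = w + μ x`, together with a closed half-line of this line. -/
def lexHalfPlane (μ w ε e : ℝ) : Set (ℝ × ℝ) :=
  {P | w < P.2 - μ * P.1 ∨ (P.2 - μ * P.1 = w ∧ e ≤ ε * P.1)}

theorem lexHalfPlane_cases {μ w ε e : ℝ} {P : ℝ × ℝ} (h : P ∈ lexHalfPlane μ w ε e) :
    w ≤ P.2 - μ * P.1 ∧ (P.2 - μ * P.1 = w → e ≤ ε * P.1) := by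
  rcases h with h | ⟨h, h'⟩
  · exact ⟨h.le, fun h1 => absurd h1 h.ne'⟩
  · exact ⟨h.ge, fun _ => h'⟩

theorem combo_eq {x y w s t : ℝ} (hs : 0 < s) (ht : 0 < t) (hst : s + t = 1) (hx : w ≤ x)
    (hy : w ≤ y) (h : s * x + t * y = w) : x = w ∧ y = w := by
  have h1 : s * (x - w) + t * (y - w) = 0 := by linear_combination h - w * hst
  have h2 : 0 ≤ s * (x - w) := mul_nonneg hs.le (by linarith)
  have h3 : 0 ≤ t * (y - w) := mul_nonneg ht.le (by linarith)
  constructor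
  · have : s * (x - w) = 0 := by linarith
    rcases mul_eq_zero.1 this with h | h <;> linarith
  · have : t * (y - w) = 0 := by linarith
    rcases mul_eq_zero.1 this with h | h <;> linarith

theorem convex_lexHalfPlane (μ w ε e : ℝ) : Convex ℝ (lexHalfPlane μ w ε e) := by
  rw [convex_iff_forall_pos]
  intro P hP Q hQ s t hs ht hst
  obtain ⟨hP1, hP2⟩ := lexHalfPlane_cases hP
  obtain ⟨hQ1, hQ2⟩ := lexHalfPlane_cases hQ
  have hcomb : (s • P + t • Q).2 - μ * (s • P + t • Q).1 =
      s * (P.2 - μ * P.1) + t * (Q.2 - μ * Q.1) := by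
    simp only [Prod.snd_add, Prod.fst_add, Prod.smul_fst, Prod.smul_snd, smul_eq_mul]
    ring
  have hge : w ≤ s * (P.2 - μ * P.1) + t * (Q.2 - μ * Q.1) := by
    calc w = s * w + t * w := by rw [← add_mul, hst, one_mul]
      _ ≤ _ := add_le_add (mul_le_mul_of_nonneg_left hP1 hs.le)
        (mul_le_mul_of_nonneg_left hQ1 ht.le)
  rcases hge.lt_or_eq with h | h
  · left
    rwa [hcomb]
  · right
    refine ⟨hcomb.trans h.symm, ?_⟩
    obtain ⟨h1, h2⟩ := combo_eq hs ht hst hP1 hQ1 h.symm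
    simp only [Prod.fst_add, Prod.smul_fst, smul_eq_mul]
    calc e = s * e + t * e := by rw [← add_mul, hst, one_mul]
      _ ≤ s * (ε * P.1) + t * (ε * Q.1) := add_le_add (mul_le_mul_of_nonneg_left (hP2 h1) hs.le)
        (mul_le_mul_of_nonneg_left (hQ2 h2) ht.le)
      _ = _ := by ring

/-- A point minimizing first `y - μ x`, then `ε x`, is extreme. The sign of `ε` selects the left or
the right end of a contact segment. -/
theorem mem_extremePoints_lexHalfPlane {μ w ε e : ℝ} (hε : ε ≠ 0) {Q : ℝ × ℝ}
    (h1 : Q.2 - μ * Q.1 = w) (h2 : ε * Q.1 = e) :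
    Q ∈ Set.extremePoints ℝ (lexHalfPlane μ w ε e) := by
  rw [mem_extremePoints]
  refine ⟨Or.inr ⟨h1, h2.ge⟩, ?_⟩
  rintro A hA B hB ⟨s, t, hs, ht, hst, rfl⟩
  obtain ⟨hA1, hA2⟩ := lexHalfPlane_cases hA
  obtain ⟨hB1, hB2⟩ := lexHalfPlane_cases hB
  have h1' : s * (A.2 - μ * A.1) + t * (B.2 - μ * B.1) = w := by
    rw [← h1]
    simp only [Prod.snd_add, Prod.fst_add, Prod.smul_fst, Prod.smul_snd, smul_eq_mul]
    ring
  obtain ⟨hA3, hB3⟩ := combo_eq hs ht hst hA1 hB1 h1'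
  have h2' : s * (ε * A.1) + t * (ε * B.1) = e := by
    rw [← h2]
    simp only [Prod.fst_add, Prod.smul_fst, smul_eq_mul]
    ring
  obtain ⟨hA4, hB4⟩ := combo_eq hs ht hst (hA2 hA3) (hB2 hB3) h2'
  have hAB : A = B := by
    have h3 : A.1 = B.1 := mul_left_cancel₀ hε (hA4.trans hB4.symm)
    refine Prod.ext h3 ?_
    rw [h3] at hA3
    linarith
  subst hAB
  rw [← add_smul, hst, one_smul]
  exact ⟨rfl, rfl⟩

theorem order_eq_of_aboveLine {p : ℕ} {μ w : ℚ} (hB : AboveLine p n a μ w) {l : ℕ} (hl : l ≤ n)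
    (h : (a l).coeff (w + (p : ℚ) ^ l * μ) ≠ 0) : (a l).order = w + (p : ℚ) ^ l * μ := by
  have hne : a l ≠ 0 := by intro h0; rw [h0] at h; exact h rfl
  have := order_eq_of_coeff (hB l hl) h
  rw [← HahnSeries.order_eq_orderTop_of_ne_zero hne] at this
  exact_mod_cast this

/-- An end point of the contact set of the Newton polygon with a supporting line is a vertex. -/
theorem isVertex_of_aboveLine {μ w : ℚ} (hB : AboveLine p n a μ w) {l : ℕ} (hl : l ≤ n)
    (h : (a l).coeff (w + (p : ℚ) ^ l * μ) ≠ 0) {ε : ℝ} (hε : ε ≠ 0)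
    (hmin : ∀ i ≤ n, (a i).coeff (w + (p : ℚ) ^ i * μ) ≠ 0 →
      ε * (p : ℝ) ^ l ≤ ε * (p : ℝ) ^ i) : (opOf p n a).IsVertex l := by
  have hne : a l ≠ 0 := by intro h0; rw [h0] at h; exact h rfl
  have hsub : (opOf p n a).newtonPolygon ⊆ lexHalfPlane μ w ε (ε * (p : ℝ) ^ l) := by
    refine convexHull_min ?_ (convex_lexHalfPlane _ _ _ _)
    rintro P ⟨i, hi, hP1, hP2⟩
    obtain ⟨i, hin, rfl⟩ := exists_of_coef_ne_zero hi
    rw [coef_opOf_natCast hin] at hi hP2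
    rw [zpow_natCast] at hP1
    have hord := (ordGE_iff_order hi).1 (hB i hin)
    by_cases hco : (a i).coeff (w + (p : ℚ) ^ i * μ) = 0
    · have hlt : w + (p : ℚ) ^ i * μ < (a i).order := by
        refine lt_of_le_of_ne hord fun he => ?_
        rw [he] at hco
        exact HahnSeries.coeff_order_eq_zero.not.2 hi hco
      left
      have : (w : ℝ) + (p : ℝ) ^ i * μ < (a i).order := by exact_mod_cast hlt
      rw [hP1]
      linarith
    · have : (w : ℝ) + (p : ℝ) ^ i * μ ≤ (a i).order := by exact_mod_cast hord
      have hge : (w : ℝ) ≤ P.2 - μ * P.1 := by rw [hP1]; linarith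
      rcases hge.lt_or_eq with h1 | h1
      · exact Or.inl h1
      · exact Or.inr ⟨h1.symm, by rw [hP1]; exact hmin i hin hco⟩
  refine ⟨by rwa [coef_opOf_natCast hl], ?_⟩
  refine inter_extremePoints_subset_extremePoints_of_subset hsub ⟨?_, ?_⟩
  · refine subset_convexHull ℝ _ ⟨l, ?_, rfl, le_rfl⟩
    rwa [coef_opOf_natCast hl]
  · refine mem_extremePoints_lexHalfPlane hε ?_ ?_
    · rw [coef_opOf_natCast hl, order_eq_of_aboveLine hB hl h, zpow_natCast]
      push_cast
      ring
    · rw [zpow_natCast]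

/-- There is no vertex strictly inside an edge. -/
theorem not_isVertex_of_between {μ w : ℚ} (hB : AboveLine p n a μ w) {i j : ℕ} (hi : i ≤ n)
    (hj : j ≤ n) (hai : (a i).coeff (w + (p : ℚ) ^ i * μ) ≠ 0)
    (haj : (a j).coeff (w + (p : ℚ) ^ j * μ) ≠ 0) {m : ℤ} (him : (i : ℤ) < m) (hmj : m < j) :
    ¬ (opOf p n a).IsVertex m := by
  rintro ⟨hm0, hm⟩
  obtain ⟨l, hl, rfl⟩ := exists_of_coef_ne_zero hm0
  rw [coef_opOf_natCast hl] at hm0 hm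
  have hord := (ordGE_iff_order hm0).1 (hB l hl)
  have hord' : (w : ℝ) + (p : ℝ) ^ l * μ ≤ (a l).order := by exact_mod_cast hord
  have hp : (1 : ℝ) < p := by exact_mod_cast one_lt_p p
  have hil : (p : ℝ) ^ i < (p : ℝ) ^ l := pow_lt_pow_right₀ hp (by exact_mod_cast him)
  have hlj : (p : ℝ) ^ l < (p : ℝ) ^ j := pow_lt_pow_right₀ hp (by exact_mod_cast hmj)
  -- The line of slope `μ` through the point of index `l` passes on or above the two end points, so
  -- the point is strictly inside a segment contained in the polygon.
  have hmem : ∀ k ≤ n, (a k).coeff (w + (p : ℚ) ^ k * μ) ≠ 0 →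
      ((p : ℝ) ^ k, (p : ℝ) ^ k * (μ : ℝ) + ((a l).order - (p : ℝ) ^ l * μ)) ∈
        (opOf p n a).newtonPolygon := by
    intro k hk hak
    refine subset_convexHull ℝ _ ⟨k, ?_, by rw [zpow_natCast], ?_⟩
    · rw [coef_opOf_natCast hk]
      intro h0
      rw [h0] at hak
      exact hak rfl
    · rw [coef_opOf_natCast hk, order_eq_of_aboveLine hB hk hak]
      push_cast
      linarith
  have hji : 0 < (p : ℝ) ^ j - (p : ℝ) ^ i := by linarith
  have h := (mem_extremePoints.1 hm).2 _ (hmem i hi hai) _ (hmem j hj haj)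
    ⟨((p : ℝ) ^ j - (p : ℝ) ^ l) / ((p : ℝ) ^ j - (p : ℝ) ^ i),
      ((p : ℝ) ^ l - (p : ℝ) ^ i) / ((p : ℝ) ^ j - (p : ℝ) ^ i),
      div_pos (by linarith) hji, div_pos (by linarith) hji, by field_simp; ring, by
        rw [zpow_natCast]
        refine Prod.ext ?_ ?_
        · simp only [Prod.fst_add, Prod.smul_fst, smul_eq_mul]
          field_simp
          ring
        · simp only [Prod.snd_add, Prod.smul_snd, smul_eq_mul]
          field_simp
          ring⟩
  have h1 := congrArg Prod.fst h.1
  simp only [zpow_natCast] at h1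
  exact hil.ne h1

theorem trailing_lt_natDegree {P : ℂ[X]} (h0 : P ≠ 0) {c : ℂ} (hc : c ≠ 0) (hr : P.IsRoot c) :
    P.natTrailingDegree < P.natDegree := by
  refine lt_of_le_of_ne P.natTrailingDegree_le_natDegree fun h => ?_
  have hP : P = monomial P.natDegree P.leadingCoeff := by
    ext k
    rw [coeff_monomial]
    split_ifs with hk
    · rw [← hk, coeff_natDegree]
    · rcases lt_or_gt_of_ne hk with hk | hk
      · exact coeff_eq_zero_of_natDegree_lt hk
      · exact coeff_eq_zero_of_lt_natTrailingDegree (h ▸ hk)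
  rw [IsRoot, hP, eval_monomial] at hr
  exact mul_ne_zero (leadingCoeff_ne_zero.2 h0) (pow_ne_zero _ hc) hr

/-- A nonzero root forces at least two monomials. The lowest and highest ones give the two ends of
the contact segment, which are consecutive vertices. -/
theorem mem_slopes_of_isRoot {μ w : ℚ} (hB : AboveLine p n a μ w) (h0 : initPoly p n a μ w ≠ 0)
    {c : ℂ} (hc : c ≠ 0) (hr : (initPoly p n a μ w).IsRoot c) : μ ∈ (opOf p n a).slopes := by
  have hlt := trailing_lt_natDegree h0 hc hr
  set P := initPoly p n a μ w with hP
  have hmem : ∀ l, P.coeff l ≠ 0 → l ≤ n ∧ (a l).coeff (w + (p : ℚ) ^ l * μ) ≠ 0 := by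
    intro l hl
    rw [hP, initPoly_coeff] at hl
    split_ifs at hl with h
    · exact ⟨h, hl⟩
    · exact absurd rfl hl
  have hp : (1 : ℝ) ≤ p := by exact_mod_cast (one_lt_p p).le
  obtain ⟨hi, hai⟩ := hmem P.natTrailingDegree (mt trailingCoeff_eq_zero.1 h0)
  obtain ⟨hj, haj⟩ := hmem P.natDegree (mt leadingCoeff_eq_zero.1 h0)
  have hne : ∀ l ≤ n, (a l).coeff (w + (p : ℚ) ^ l * μ) ≠ 0 → P.coeff l ≠ 0 := by
    intro l hl h
    rwa [hP, initPoly_coeff_of_le _ _ hl]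
  have hvi := isVertex_of_aboveLine hB hi hai one_ne_zero (fun l hl hal => by
    rw [one_mul, one_mul]
    exact pow_le_pow_right₀ hp (natTrailingDegree_le_of_ne_zero (hne l hl hal)))
  have hvj := isVertex_of_aboveLine hB hj haj (neg_ne_zero.2 one_ne_zero) (fun l hl hal => by
    rw [neg_one_mul, neg_one_mul, neg_le_neg_iff]
    exact pow_le_pow_right₀ hp (le_natDegree_of_ne_zero (hne l hl hal)))
  refine ⟨P.natDegree - P.natTrailingDegree, P.natTrailingDegree, P.natDegree,
    ⟨hvi, hvj, by exact_mod_cast hlt, fun m hm hm' =>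
      not_isVertex_of_between hB hi hj hai haj hm'.1 hm'.2 hm⟩, ?_, by omega⟩
  rw [Op.edgeSlope, coef_opOf_natCast hi, coef_opOf_natCast hj, order_eq_of_aboveLine hB hi hai,
    order_eq_of_aboveLine hB hj haj, zpow_natCast, zpow_natCast]
  have := pow_lt_pow_right₀ (one_lt_p p) hlt
  rw [div_eq_iff (by linarith)]
  ring

/-! ### From the Newton polygon to the multiset of slopes and exponents -/

theorem filter_finset_sum {α ι : Type*} (q : α → Prop) [DecidablePred q] (s : Finset ι)
    (M : ι → Multiset α) : (∑ i ∈ s, M i).filter q = ∑ i ∈ s, (M i).filter q := by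
  classical
  induction s using Finset.induction_on with
  | empty => simp
  | insert i s hi ih => rw [Finset.sum_insert hi, Finset.sum_insert hi, Multiset.filter_add, ih]

/-- For a listed slope, the initial polynomial is the characteristic polynomial. For any other one
it has no nonzero root, since such a root would make it a slope of the Newton polygon. -/
theorem hasExponents_opOf {k : ℕ} {μ : Fin k → ℚ} {r : Fin k → ℕ}
    {c : (i : Fin k) → Fin (r i) → ℂ} (hμ : Function.Injective μ)
    (hslopes : (opOf p n a).slopes ⊆ Set.range μ)
    (hc : ∀ i, Multiset.map (c i) Finset.univ.val = (opOf p n a).exponents (μ i)) :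
    HasExponents p n a
      (∑ i, ((List.ofFn fun j => (μ i, c i j) : List (ℚ × ℂ)) : Multiset _)) := by
  intro ρ w hB h0
  have hneg : ∀ i, μ i ≠ ρ →
      (((List.ofFn fun j => (μ i, c i j) : List (ℚ × ℂ)) : Multiset (ℚ × ℂ)).filter
        fun x => x.1 = ρ) = 0 := by
    intro i hi
    rw [Multiset.filter_eq_nil]
    intro x hx
    rw [Multiset.mem_coe, List.mem_ofFn] at hx
    obtain ⟨j, rfl⟩ := hx
    exact hi
  rw [filter_finset_sum]
  by_cases hρ : ρ ∈ Set.range μ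
  · obtain ⟨i, rfl⟩ := hρ
    rw [Finset.sum_eq_single i (fun j _ hj => hneg j (hμ.ne hj))
      (fun h => absurd (Finset.mem_univ i) h), (Multiset.filter_eq_self (p := fun x : ℚ × ℂ => x.1 = μ i)).2,
      Multiset.map_coe,
      List.map_ofFn]
    · have h1 := hc i
      rw [Op.exponents, charPoly_opOf hB h0, Fin.univ_val_map] at h1
      exact h1.symm
    · intro x hx
      rw [Multiset.mem_coe, List.mem_ofFn] at hx
      obtain ⟨j, rfl⟩ := hx
      rfl
  · rw [Finset.sum_eq_zero (fun i _ => hneg i fun h => hρ ⟨i, h⟩), Multiset.map_zero,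
      Multiset.filter_eq_nil]
    intro c hr hc
    exact hρ (hslopes (mem_slopes_of_isRoot hB h0 hc (isRoot_of_mem_roots hr)))

end Mahler

theorem mainTheorem2 (p : ℕ) [p.AtLeastTwo] (n : ℕ) (a : Fin (n + 1) → Mahler.Hahn)
    (ha0 : a 0 ≠ 0) (han : a (Fin.last n) ≠ 0) (L : Mahler.Op p)
    (hL : L = ∑ i : Fin (n + 1), Mahler.Op.const p (a i) * Mahler.Op.Phi p ^ (i : ℕ))
    (k : ℕ) (μ : Fin k → ℚ) (r : Fin k → ℕ)
    (hμ : StrictMono μ) (hslopes : Set.range μ = L.slopes)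
    (hr : ∀ i, L.IsSlopeWithMult (μ i) (r i))
    (c : (i : Fin k) → Fin (r i) → ℂ)
    (hc : ∀ i, Multiset.map (c i) Finset.univ.val = L.exponents (μ i)) :
    ∃ (b : Mahler.Hahn) (h : (i : Fin k) → Fin (r i) → Mahler.Hahn),
      b ≠ 0 ∧
      b.orderTop = (a 0).orderTop ∧
      b.leadingCoeff = (∏ i : Fin k, ∏ j : Fin (r i), (-(c i j))⁻¹) * (a 0).leadingCoeff ∧
      (∀ i j, Mahler.TangentToId (h i j)) ∧
      L = Mahler.Op.const p b *
        Mahler.descProd (fun i : Fin k =>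
          Mahler.descProd (fun j : Fin (r i) =>
            Mahler.linFactor p (Mahler.nu p μ r i) (c i j) (h i j))) := by
  let a' : ℕ → Mahler.Hahn := fun l => if hl : l < n + 1 then a ⟨l, hl⟩ else 0
  have ha' : ∀ i : Fin (n + 1), a' i = a i := fun i => dif_pos i.2
  have hLa : L = Mahler.opOf p n a' := by
    rw [hL, Mahler.opOf,
      ← Fin.sum_univ_eq_sum_range (fun l => Mahler.Op.const p (a' l) * Mahler.Op.Phi p ^ l)]
    simp only [ha']
  have ha'0 : a' 0 = a 0 := ha' 0
  subst hLa
  rw [← ha'0] at ha0 ⊢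
  exact Mahler.exists_factorization k a' μ r c ha0 hμ
    (Mahler.hasExponents_opOf hμ.injective hslopes.ge hc)
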